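/- Let $f:\mathbb R\to\mathbb R$ be of class $C^2$ near $0$ (in particular, any $f$ that is smooth near $0$ is allowed), even on a neighbourhood of $0$, and such that $f(x)=-a\,x^2+O(|x|^4)$ as $x\to0$ for some constant $a>0$. For $x_0>0$ and $0<\alpha<1$ consider the solution $x(t)$, $t\ge 0$, of the damped pendulum equation \[ \ddot x+2\alpha\,\dot x+x\,(1+f(x))=0,\qquad x(0)=x_0,\quad \dot x(0)=0, \] and let the oscillation time $\tau(x_0,\alpha)$ be the smallest $t>0$ at which $x$ has a local maximum. Then there is $\delta>0$ such that for every fixed $x_0$ with $0<x_0<\delta$: (i) for every $\alpha\in(0,1)$ the solution exists for all $t\ge0$ and $\tau(x_0,\alpha)$ is well defined (it is finite, the smallest such $t$ exists, and it does not depend on the choice of a solution); (ii) the function $\alpha\mapsto\tau(x_0,\alpha)$ on $(0,1)$ attains a positive minimum: there is $\alpha_0\in(0,1)$ with $0<\tau(x_0,\alpha_0)\le\tau(x_0,\alpha)$ for all $\alpha\in(0,1)$; (iii) $\lim_{\alpha\to1^-}\tau(x_0,\alpha)=\infty$. -/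

import Mathlib

open Set Filter Topology Asymptotics

/-- The pair `(x, v)` solves, for all times `t ≥ 0`, the damped pendulum equation
`x'' + 2 α x' + x (1 + f x) = 0` in phase-space form (`x' = v`), with initial position `x₀`
and vanishing initial velocity. Derivatives at `t = 0` are one-sided. -/
structure IsPendulumSolution (f : ℝ → ℝ) (x₀ α : ℝ) (x v : ℝ → ℝ) : Prop where
  init_pos : x 0 = x₀
  init_vel : v 0 = 0
  deriv_pos : ∀ t, 0 ≤ t → HasDerivWithinAt x (v t) (Ici 0) t
  deriv_vel : ∀ t, 0 ≤ t →
    HasDerivWithinAt v (-(2 * α * v t) - x t * (1 + f (x t))) (Ici 0) t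

/-- `T` is the oscillation time for the data `x₀`, `α`: the motion started at `x₀` with vanishing
velocity exists for all `t ≥ 0`, and `T` is the first time after `0` at which it has a local
maximum. Quantifying over all solutions makes `T` independent of the choice of a solution. -/
def IsOscillationTime (f : ℝ → ℝ) (x₀ α T : ℝ) : Prop :=
  (∃ x v, IsPendulumSolution f x₀ α x v) ∧
    ∀ x v, IsPendulumSolution f x₀ α x v → IsLeast {t : ℝ | 0 < t ∧ IsLocalMax x t} T

/-- The oscillation time `τ(x₀, α)` as a function: the infimum of the positive times at which the
motion started at `x₀` with vanishing velocity has a local maximum. It is meaningful when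
`IsOscillationTime f x₀ α (oscillationTime f x₀ α)` holds, i.e. when that first maximum exists. -/
noncomputable def oscillationTime (f : ℝ → ℝ) (x₀ α : ℝ) : ℝ :=
  sInf {t : ℝ | 0 < t ∧ ∃ x v, IsPendulumSolution f x₀ α x v ∧ IsLocalMax x t}

theorem exists_forall_hasDerivAt_of_lipschitzWith_of_bounded {E : Type*} [NormedAddCommGroup E]
    [NormedSpace ℝ E] [CompleteSpace E] {F : E → E} {K M : NNReal} (hF : LipschitzWith K F)
    (hM : ∀ x, ‖F x‖ ≤ M) (x₀ : E) :
    ∃ u : ℝ → E, u 0 = x₀ ∧ ∀ t, HasDerivAt u (F (u t)) t := by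
  have key : ∀ n : ℕ, ∃ u : ℝ → E, u 0 = x₀ ∧
      ∀ t ∈ Ioo (-(n + 1 : ℝ)) (n + 1), HasDerivAt u (F (u t)) t := by
    intro n
    have hn : (0 : ℝ) ∈ Icc (-(n + 1 : ℝ)) (n + 1) := ⟨by linarith [n.cast_nonneg (α := ℝ)],
      by linarith [n.cast_nonneg (α := ℝ)]⟩
    have hP : IsPicardLindelof (fun _ => F) (⟨0, hn⟩ : Icc (-(n + 1 : ℝ)) (n + 1)) x₀
        (M * (n + 1)) 0 M K := by
      refine ⟨fun t _ => hF.lipschitzOnWith, fun x _ => continuousOn_const, fun t _ x _ => hM x, ?_⟩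
      simp
    obtain ⟨u, hu0, hu⟩ := hP.exists_eq_forall_mem_Icc_hasDerivWithinAt₀
    exact ⟨u, hu0, fun t ht => (hu t (Ioo_subset_Icc_self ht)).hasDerivAt (Icc_mem_nhds ht.1 ht.2)⟩
  choose U hU0 hU using key
  have agree : ∀ m n : ℕ, m ≤ n → ∀ t : ℝ, |t| < m + 1 → U m t = U n t := by
    intro m n hmn t ht
    have hmn' : (m : ℝ) ≤ n := by exact_mod_cast hmn
    refine ODE_solution_unique_of_mem_Ioo (v := fun _ => F) (s := fun _ => univ) (t₀ := 0)
      (a := -(m + 1 : ℝ)) (b := m + 1) (K := K) (fun t _ => hF.lipschitzOnWith) ?_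
      (fun s hs => ⟨hU m s hs, trivial⟩)
      (fun s hs => ⟨hU n s ⟨by linarith [hs.1], by linarith [hs.2]⟩, trivial⟩)
      ((hU0 m).trans (hU0 n).symm) (abs_lt.1 ht)
    constructor <;> linarith [m.cast_nonneg (α := ℝ)]
  refine ⟨fun t => U ⌈|t|⌉₊ t, by simp [hU0], fun t => ?_⟩
  have hlt : ∀ s : ℝ, |s| < (⌈|s|⌉₊ : ℝ) + 1 := fun s => (Nat.le_ceil _).trans_lt (by linarith)
  have h1 : HasDerivAt (U (⌈|t|⌉₊ + 1)) (F (U (⌈|t|⌉₊ + 1) t)) t := by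
    apply hU
    rw [mem_Ioo, ← abs_lt]
    push_cast
    linarith [hlt t]
  rw [← agree _ _ (Nat.le_succ ⌈|t|⌉₊) t (hlt t)] at h1
  refine h1.congr_of_eventuallyEq ?_
  have : ∀ᶠ s in 𝓝 t, |s| < (⌈|t|⌉₊ : ℝ) + 1 := continuous_abs.continuousAt.eventually_lt_const (hlt t)
  filter_upwards [this] with s hs
  refine agree _ _ ?_ s (hlt s)
  rw [Nat.ceil_le]
  push_cast
  exact hs.le

/-- If `u` starts at a nonnegative value and increases strictly whenever it vanishes,
then it is positive at all later times. -/
theorem pos_of_deriv_pos_of_eq_zero {u u' : ℝ → ℝ} {a : ℝ}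
    (hu : ∀ t, a ≤ t → HasDerivAt u (u' t) t) (h0 : 0 ≤ u a)
    (hpos : ∀ t, a ≤ t → u t = 0 → 0 < u' t) {t : ℝ} (ht : a < t) : 0 < u t := by
  have hnn : ∀ s, a ≤ s → 0 ≤ u s := by
    intro s hs
    have := image_le_of_deriv_right_lt_deriv_boundary (f := fun t => -u t) (f' := fun t => -u' t)
      (B := fun _ => 0) (B' := fun _ => 0) (a := a) (b := s)
      (fun t ht => (hu t ht.1).neg.continuousAt.continuousWithinAt)
      (fun t ht => (hu t ht.1).neg.hasDerivWithinAt) (by simpa using h0)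
      (fun x => hasDerivAt_const x 0)
      (fun x hx h => by simpa using hpos x hx.1 (by simpa using h)) ⟨hs, le_rfl⟩
    simpa using this
  refine lt_of_le_of_ne (hnn t ht.le) fun h => ?_
  have hmin : IsLocalMin u t := by
    filter_upwards [lt_mem_nhds ht] with s hs
    rw [← h]
    exact hnn s (le_of_lt hs)
  have := hmin.hasDerivAt_eq_zero (hu t ht.le)
  linarith [hpos t ht.le h.symm]

section Expansion
variable {f : ℝ → ℝ} {a : ℝ}

theorem tendsto_div_sq_of_expansion
    (hf : (fun x : ℝ => f x - (-a * x ^ 2)) =O[𝓝 0] (fun x : ℝ => |x| ^ 4)) :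
    Tendsto (fun x => f x / x ^ 2) (𝓝[≠] 0) (𝓝 (-a)) := by
  have h1 : (fun x : ℝ => |x| ^ 4) =o[𝓝 0] (fun x : ℝ => x ^ 2) := by
    have : (fun x : ℝ => x ^ 4) =o[𝓝 0] (fun x : ℝ => x ^ 2) :=
      isLittleO_pow_pow (by norm_num)
    refine this.congr_left fun x => ?_
    rw [← abs_pow, abs_of_nonneg (by positivity)]
  have h2 := (hf.trans_isLittleO h1).tendsto_div_nhds_zero
  have h3 := (h2.mono_left (nhdsWithin_le_nhds (s := {0}ᶜ))).add_const (-a)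
  rw [zero_add] at h3
  refine h3.congr' ?_
  filter_upwards [self_mem_nhdsWithin] with x hx
  have hx : x ≠ 0 := hx
  field_simp
  ring

theorem apply_zero_of_expansion
    (hf : (fun x : ℝ => f x - (-a * x ^ 2)) =O[𝓝 0] (fun x : ℝ => |x| ^ 4)) : f 0 = 0 := by
  have := hf.eq_zero_imp.self_of_nhds
  simpa using this

theorem tendsto_deriv_div_of_expansion (hs : ContDiffAt ℝ 2 f 0)
    (hf : (fun x : ℝ => f x - (-a * x ^ 2)) =O[𝓝 0] (fun x : ℝ => |x| ^ 4)) :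
    Tendsto (fun x => deriv f x / x) (𝓝[≠] 0) (𝓝 (-2 * a)) := by
  have hq := tendsto_div_sq_of_expansion hf
  have h0 := apply_zero_of_expansion hf
  have hd : ∀ᶠ x in 𝓝 (0 : ℝ), HasDerivAt f (deriv f x) x := by
    filter_upwards [hs.eventually (by simp)] with x hx
    exact (hx.differentiableAt (by norm_num)).hasDerivAt
  have hid : Tendsto (fun x : ℝ => x) (𝓝[≠] 0) (𝓝 0) := tendsto_id.mono_left nhdsWithin_le_nhds
  have hd0 : deriv f 0 = 0 := by
    have h1 := hasDerivAt_iff_tendsto_slope.1 hd.self_of_nhds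
    have h2 : Tendsto (slope f 0) (𝓝[≠] 0) (𝓝 (0 * -a)) := by
      refine (hid.mul hq).congr' ?_
      filter_upwards [self_mem_nhdsWithin] with x hx
      have hx : x ≠ 0 := hx
      rw [slope_def_field, h0]
      field_simp
      ring
    simpa using tendsto_nhds_unique h1 h2
  have hdd : DifferentiableAt ℝ (deriv f) 0 := by
    have : ContDiffAt ℝ 1 (deriv f) 0 := by
      exact hs.derivWithin (by norm_num)
    exact this.differentiableAt (by norm_num)
  have hb := hasDerivAt_iff_tendsto_slope.1 hdd.hasDerivAt
  have hb' : Tendsto (fun x => deriv f x / x) (𝓝[≠] 0) (𝓝 (deriv (deriv f) 0)) := by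
    refine hb.congr fun x => ?_
    rw [slope_def_field, hd0]; simp
  have hl : Tendsto (fun x => f x / x ^ 2) (𝓝[≠] 0) (𝓝 (deriv (deriv f) 0 / 2)) := by
    refine HasDerivAt.lhopital_zero_nhdsNE (f' := deriv f) (g' := fun x => 2 * x)
      (hd.filter_mono nhdsWithin_le_nhds) (Eventually.of_forall fun x => by
        simpa using hasDerivAt_pow 2 x) ?_ ?_ ?_ ?_
    · filter_upwards [self_mem_nhdsWithin] with x hx
      have hx : x ≠ 0 := hx
      positivity
    · have := hd.self_of_nhds.continuousAt.tendsto
      rw [h0] at this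
      exact this.mono_left nhdsWithin_le_nhds
    · simpa using hid.pow 2
    · refine (hb'.div_const 2).congr fun x => ?_
      rw [div_div, mul_comm x]
  have := tendsto_nhds_unique hl hq
  rwa [show -2 * a = deriv (deriv f) 0 by linarith]

/-- A primitive of a function that is continuous near `0`. -/
theorem exists_eventually_hasDerivAt_primitive {g : ℝ → ℝ} (hg : ∀ᶠ x in 𝓝 (0 : ℝ), ContinuousAt g x) :
    ∃ G : ℝ → ℝ, G 0 = 0 ∧ ∀ᶠ x in 𝓝 (0 : ℝ), HasDerivAt G (g x) x := by
  obtain ⟨ε, hε, hball⟩ := Metric.eventually_nhds_iff.1 hg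
  have hcont : ContinuousOn g (Icc (-(ε / 2)) (ε / 2)) := fun x hx =>
    (hball (by rw [Real.dist_eq, sub_zero, abs_lt]; constructor <;> linarith [hx.1, hx.2])).continuousWithinAt
  have hle : -(ε / 2) ≤ ε / 2 := by linarith
  have hc : Continuous (IccExtend hle ((Icc (-(ε / 2)) (ε / 2)).domRestrict g)) :=
    (continuousOn_iff_continuous_domRestrict.1 hcont).Icc_extend'
  refine ⟨fun x => ∫ t in (0 : ℝ)..x, IccExtend hle ((Icc (-(ε / 2)) (ε / 2)).domRestrict g) t,
    by simp, ?_⟩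
  filter_upwards [Icc_mem_nhds (show -(ε / 2) < 0 by linarith) (show 0 < ε / 2 by linarith)] with x hx
  have := hc.integral_hasStrictDerivAt 0 x
  have h2 := this.hasDerivAt
  rwa [IccExtend_of_mem hle _ hx] at h2

/-- Near the origin the potential energy `V` of the restoring force `x (1 + f x)` is `S ^ 2 / 2` for
a coordinate `S`; its derivative `k = V' / S` is close to `1 - 3 a x ^ 2 / 4`. -/
theorem exists_energy_coordinate (ha : 0 < a) (hs : ContDiffAt ℝ 2 f 0)
    (hf : (fun x : ℝ => f x - (-a * x ^ 2)) =O[𝓝 0] (fun x : ℝ => |x| ^ 4)) :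
    ∃ S k k' : ℝ → ℝ, S 0 = 0 ∧ k 0 = 1 ∧ ∀ᶠ x in 𝓝 (0 : ℝ),
      HasDerivAt S (k x) x ∧ S x * k x = x * (1 + f x) ∧ HasDerivAt k (k' x) x ∧
        x * k' x ≤ -a * x ^ 2 ∧ |k' x| ≤ 2 * a * |x| := by
  have hq := tendsto_div_sq_of_expansion hf
  have h0 := apply_zero_of_expansion hf
  have hf' := tendsto_deriv_div_of_expansion hs hf
  have hd : ∀ᶠ x in 𝓝 (0 : ℝ), HasDerivAt f (deriv f x) x := by
    filter_upwards [hs.eventually (by simp)] with x hx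
    exact (hx.differentiableAt (by norm_num)).hasDerivAt
  have hid : Tendsto (fun x : ℝ => x) (𝓝[≠] 0) (𝓝 0) := tendsto_id.mono_left nhdsWithin_le_nhds
  have hne : ∀ᶠ x in 𝓝[≠] (0 : ℝ), x ≠ 0 := self_mem_nhdsWithin
  have hft : Tendsto f (𝓝[≠] 0) (𝓝 0) := by
    have := hd.self_of_nhds.continuousAt.tendsto
    rw [h0] at this
    exact this.mono_left nhdsWithin_le_nhds
  obtain ⟨G, hG0, hG⟩ := exists_eventually_hasDerivAt_primitive (g := fun x => x * (1 + f x))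
    (by
      filter_upwards [hd] with x hx
      exact continuousAt_id.mul (continuousAt_const.add hx.continuousAt))
  have hGt : Tendsto G (𝓝[≠] 0) (𝓝 0) := by
    have := hG.self_of_nhds.continuousAt.tendsto
    rw [hG0] at this
    exact this.mono_left nhdsWithin_le_nhds
  have t1 : Tendsto (fun x => (2 * G x - x ^ 2) / x ^ 4) (𝓝[≠] 0) (𝓝 (-a / 2)) := by
    refine HasDerivAt.lhopital_zero_nhdsNE (f' := fun x => 2 * (x * (1 + f x)) - 2 * x)
      (g' := fun x => 4 * x ^ 3) ?_ ?_ ?_ ?_ ?_ ?_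
    · filter_upwards [hG.filter_mono nhdsWithin_le_nhds] with x hx
      simpa using (hx.const_mul 2).fun_sub (hasDerivAt_pow 2 x)
    · exact Eventually.of_forall fun x => by simpa using hasDerivAt_pow 4 x
    · filter_upwards [hne] with x hx
      positivity
    · simpa using (hGt.const_mul 2).sub (hid.pow 2)
    · simpa using hid.pow 4
    · refine (hq.div_const 2).congr' ?_
      filter_upwards [hne] with x hx
      field_simp
      ring
  set m : ℝ → ℝ := fun x => if x = 0 then 1 else 2 * G x / x ^ 2 with hm
  set m' : ℝ → ℝ := fun x => (2 * (1 + f x) - 2 * m x) / x with hm'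
  set k : ℝ → ℝ := fun x => (1 + f x) / √(m x) with hk
  set k' : ℝ → ℝ := fun x =>
    if x = 0 then 0 else (deriv f x - (1 + f x) * m' x / (2 * m x)) / √(m x) with hk'
  have hm0 : m 0 = 1 := by simp [hm]
  have hmne : ∀ x, x ≠ 0 → m x = 2 * G x / x ^ 2 := fun x hx => by simp [hm, hx]
  have t2 : Tendsto (fun x => (m x - 1) / x ^ 2) (𝓝[≠] 0) (𝓝 (-a / 2)) := by
    refine t1.congr' ?_
    filter_upwards [hne] with x hx
    rw [hmne x hx]
    field_simp
  have t3 : Tendsto m (𝓝[≠] 0) (𝓝 1) := by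
    have := ((hid.pow 2).mul t2).add_const 1
    simp only [ne_eq, OfNat.ofNat_ne_zero, not_false_eq_true, zero_pow, zero_mul, zero_add] at this
    refine this.congr' ?_
    filter_upwards [hne] with x hx
    field_simp
    ring
  have hmc : ContinuousAt m 0 := by
    rw [continuousAt_iff_punctured_nhds, hm0]
    exact t3
  have t4 : Tendsto (fun x => m' x / x) (𝓝[≠] 0) (𝓝 (-a)) := by
    have := (hq.const_mul 2).sub (t2.const_mul 2)
    rw [show 2 * -a - 2 * (-a / 2) = -a by ring] at this
    refine this.congr' ?_
    filter_upwards [hne] with x hx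
    simp only [hm']
    field_simp
    ring
  have tsq : Tendsto (fun x => √(m x)) (𝓝[≠] 0) (𝓝 1) := by
    simpa using t3.sqrt
  have t5 : Tendsto (fun x => k' x / x) (𝓝[≠] 0) (𝓝 (-3 * a / 2)) := by
    have := (hf'.sub (((hft.const_add 1).mul t4).div (t3.const_mul 2) (by norm_num))).div tsq
      (by norm_num)
    rw [show (-2 * a - (1 + 0) * -a / (2 * 1)) / 1 = -3 * a / 2 by ring] at this
    refine this.congr' ?_
    filter_upwards [hne] with x hx
    simp only [hk', if_neg hx, Pi.div_apply]
    field_simp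
  have hmpos : ∀ᶠ x in 𝓝 (0 : ℝ), 0 < m x := hmc.eventually_const_lt (by simp [hm0])
  have hmd : ∀ᶠ x in 𝓝[≠] (0 : ℝ), HasDerivAt m (m' x) x := by
    filter_upwards [hne, hG.filter_mono nhdsWithin_le_nhds] with x hx hGx
    have h1 : HasDerivAt (fun x => 2 * G x / x ^ 2) _ x :=
      (hGx.const_mul 2).div (hasDerivAt_pow 2 x) (by positivity)
    refine (h1.congr_of_eventuallyEq ?_).congr_deriv ?_
    · filter_upwards [isOpen_ne.mem_nhds hx] with y hy
      exact hmne y hy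
    · simp only [hm', hmne x hx]
      field_simp
      push_cast
      ring
  have hk0 : k 0 = 1 := by simp [hk, hm0, h0]
  have hSd : ∀ᶠ x in 𝓝[≠] (0 : ℝ), HasDerivAt (fun x => x * √(m x)) (k x) x := by
    filter_upwards [hne, hmd, hmpos.filter_mono nhdsWithin_le_nhds] with x hx h1 h2
    refine ((hasDerivAt_id x).mul (h1.sqrt h2.ne')).congr_deriv ?_
    have h3 : √(m x) ≠ 0 := (Real.sqrt_pos.2 h2).ne'
    simp only [hk, hm', id]
    field_simp
    rw [Real.sq_sqrt h2.le]
    ring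
  have hkd : ∀ᶠ x in 𝓝[≠] (0 : ℝ), HasDerivAt k (k' x) x := by
    filter_upwards [hne, hmd, hmpos.filter_mono nhdsWithin_le_nhds,
      hd.filter_mono nhdsWithin_le_nhds] with x hx h1 h2 h4
    have h3 : √(m x) ≠ 0 := (Real.sqrt_pos.2 h2).ne'
    refine ((h4.const_add 1).div (h1.sqrt h2.ne') h3).congr_deriv ?_
    simp only [hk', if_neg hx]
    have h5 : m x = √(m x) ^ 2 := (Real.sq_sqrt h2.le).symm
    generalize √(m x) = w at *
    rw [h5]
    field_simp
  have hS0 : HasDerivAt (fun x => x * √(m x)) (k 0) 0 := by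
    rw [hasDerivAt_iff_tendsto_slope, hk0]
    refine tsq.congr' ?_
    filter_upwards [hne] with x hx
    rw [slope_def_field]
    field_simp
    simp
  have hk'0 : HasDerivAt k (k' 0) 0 := by
    rw [hasDerivAt_iff_tendsto_slope, show k' 0 = 0 by simp [hk']]
    have hkt : Tendsto k (𝓝[≠] 0) (𝓝 1) := by
      have := (hft.const_add 1).div tsq (by norm_num)
      rwa [add_zero, div_one] at this
    have : Tendsto (fun x => (k x - 1) / x) (𝓝[≠] 0) (𝓝 0) := by
      refine HasDerivAt.lhopital_zero_nhdsNE (f' := k') (g' := fun x => 1) ?_ ?_ ?_ ?_ ?_ ?_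
      · filter_upwards [hkd] with x hx
        exact hx.sub_const 1
      · exact Eventually.of_forall fun x => hasDerivAt_id x
      · simp
      · simpa using hkt.sub_const 1
      · exact hid
      · have := hid.mul t5
        rw [zero_mul] at this
        refine this.congr' ?_
        filter_upwards [hne] with x hx
        field_simp
    refine this.congr fun x => ?_
    rw [slope_def_field, hk0, sub_zero]
  refine ⟨fun x => x * √(m x), k, k', by simp, hk0, ?_⟩
  have hall : ∀ᶠ x in 𝓝[≠] (0 : ℝ), HasDerivAt (fun x => x * √(m x)) (k x) x ∧
      HasDerivAt k (k' x) x ∧ x * k' x ≤ -a * x ^ 2 ∧ |k' x| ≤ 2 * a * |x| := by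
    filter_upwards [hSd, hkd, hne, t5.eventually_lt_const (show -3 * a / 2 < -a by linarith),
      t5.eventually_const_lt (show -2 * a < -3 * a / 2 by linarith)] with x h1 h2 h3 h4 h5
    refine ⟨h1, h2, ?_, ?_⟩
    · have h6 := mul_le_mul_of_nonneg_right h4.le (sq_nonneg x)
      calc x * k' x = k' x / x * x ^ 2 := by field_simp
        _ ≤ _ := h6
    · have h6 : |k' x / x| ≤ 2 * a := by
        rw [abs_le]; constructor <;> linarith
      rwa [abs_div, div_le_iff₀ (abs_pos.2 h3)] at h6
  rw [eventually_nhdsWithin_iff] at hall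
  filter_upwards [hall, hmpos] with x hx hmx
  have h3 : √(m x) ≠ 0 := (Real.sqrt_pos.2 hmx).ne'
  have hmul : x * √(m x) * k x = x * (1 + f x) := by
    simp only [hk]
    field_simp
  by_cases h : x = 0
  · subst h
    exact ⟨hS0, hmul, hk'0, by simp, by simp [hk']⟩
  · obtain ⟨h1, h2, h4, h5⟩ := hx h
    exact ⟨h1, hmul, h2, h4, h5⟩

end Expansion

/-- A coordinate change `x = X s` on `[-R, R]` in which the potential energy of the force `g`
is `s ^ 2 / 2`, so that `x' = v`, `v' = -g x` becomes `s' = h s * v`, `v' = -h s * s`. -/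
structure EnergyChart (g : ℝ → ℝ) (R c : ℝ) (X h : ℝ → ℝ) : Prop where
  hasDerivAt : ∀ s, |s| ≤ R → HasDerivAt X (h s)⁻¹ s
  force : ∀ s, |s| ≤ R → g (X s) = h s * s
  smooth : ∀ s, |s| ≤ R → ContDiffAt ℝ 1 g (X s)
  lipschitz : ∃ K, LipschitzWith K h
  half_le : ∀ s, 1 / 2 ≤ h s
  le_one : ∀ s, h s ≤ 1
  zero : h 0 = 1
  gain_pos : 0 < c
  gain : ∀ s l, |s| ≤ R → 0 ≤ l → l ≤ 1 → h s + c * (s ^ 2 * (1 - l ^ 2)) ≤ h (l * s)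

theorem exists_energyChart {f : ℝ → ℝ} {a : ℝ} (ha : 0 < a) (hs : ContDiffAt ℝ 2 f 0)
    (hf : (fun x : ℝ => f x - (-a * x ^ 2)) =O[𝓝 0] (fun x : ℝ => |x| ^ 4)) :
    ∃ (R : ℝ) (X h : ℝ → ℝ), EnergyChart (fun x => x * (1 + f x)) R (a / 4) X h ∧
      ∃ δ > 0, ∀ x₀, 0 < x₀ → x₀ < δ → ∃ s₀, 0 < s₀ ∧ s₀ ≤ R ∧ X s₀ = x₀ := by
  obtain ⟨S, k, k', hS0, hk0, hev⟩ := exists_energy_coordinate ha hs hf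
  have hf0 := apply_zero_of_expansion hf
  have hfc : ContinuousAt f 0 := hs.continuousAt
  have hkc : ContinuousAt k 0 := hev.self_of_nhds.2.2.1.continuousAt
  have hst : HasStrictDerivAt S 1 0 := by
    have := hasStrictDerivAt_of_hasDerivAt_of_continuousAt (hev.mono fun x hx => hx.1) hkc
    rwa [hk0] at this
  set e := (hst.hasStrictFDerivAt_equiv one_ne_zero).toOpenPartialHomeomorph S with he
  have hecoe : ∀ x, e x = S x := fun x => rfl
  have hsrc : (0 : ℝ) ∈ e.source :=
    (hst.hasStrictFDerivAt_equiv one_ne_zero).mem_toOpenPartialHomeomorph_source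
  have htgt : (0 : ℝ) ∈ e.target := by
    have := e.map_source hsrc
    rwa [hecoe, hS0] at this
  have hX0 : e.symm 0 = 0 := by
    have := e.left_inv hsrc
    rwa [hecoe, hS0] at this
  have hXt : Tendsto e.symm (𝓝 0) (𝓝 0) := by
    have := (e.symm.continuousAt htgt).tendsto
    rwa [hX0] at this
  have hgood : ∀ᶠ x in 𝓝 (0 : ℝ), (HasDerivAt S (k x) x ∧ S x * k x = x * (1 + f x) ∧
      HasDerivAt k (k' x) x ∧ x * k' x ≤ -a * x ^ 2 ∧ |k' x| ≤ 2 * a * |x|) ∧ 1 / 2 < k x ∧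
      -(1 / 2) < f x ∧ f x < 1 ∧ |x| < 1 ∧ ContDiffAt ℝ 2 f x :=
    hev.and ((hkc.eventually_const_lt (by rw [hk0]; norm_num)).and
      ((hfc.eventually_const_lt (by rw [hf0]; norm_num)).and
      ((hfc.eventually_lt_const (by rw [hf0]; norm_num)).and
      ((continuous_abs.continuousAt.eventually_lt_const (by simp)).and
        (hs.eventually (by simp))))))
  obtain ⟨ε, hε, hball⟩ := Metric.eventually_nhds_iff.1
    ((hXt.eventually hgood).and (e.open_target.mem_nhds htgt))
  set R := ε / 2 with hR
  have hRpos : 0 < R := by positivity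
  have H : ∀ s, |s| ≤ R → _ := fun s hs => @hball s (by rw [Real.dist_eq, sub_zero]; linarith)
  clear_value R
  have hSX : ∀ s, |s| ≤ R → S (e.symm s) = s := fun s hs => e.right_inv (H s hs).2
  have hXd : ∀ s, |s| ≤ R → HasDerivAt e.symm (k (e.symm s))⁻¹ s := fun s hs =>
    e.hasDerivAt_symm (H s hs).2 (by linarith [(H s hs).1.2.1]) (H s hs).1.1.1
  have hkd : ∀ s, |s| ≤ R → HasDerivAt (fun s => k (e.symm s))
      (k' (e.symm s) * (k (e.symm s))⁻¹) s := fun s hs =>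
    (H s hs).1.1.2.2.1.comp s (hXd s hs)
  have hsign : ∀ s, |s| ≤ R → s * (k' (e.symm s) * (k (e.symm s))⁻¹) ≤ -(a / 2) * s ^ 2 := by
    intro s hs
    obtain ⟨⟨⟨-, h1, -, h2, -⟩, h3, h4, h5, -⟩, -⟩ := H s hs
    rw [hSX s hs] at h1
    generalize e.symm s = x at *
    have hkp : 0 < k x := by linarith
    have e1 : s = x * (1 + f x) / k x := by field_simp; linarith
    have e2 : s * (k' x * (k x)⁻¹) = (1 + f x) / k x ^ 2 * (x * k' x) := by
      rw [e1]; field_simp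
    rw [e2]
    calc (1 + f x) / k x ^ 2 * (x * k' x) ≤ (1 + f x) / k x ^ 2 * (-a * x ^ 2) := by
          refine mul_le_mul_of_nonneg_left h2 ?_
          have : 0 ≤ 1 + f x := by linarith
          positivity
      _ ≤ -(a / 2) * s ^ 2 := by
          have : 0 ≤ a * (1 + f x) * x ^ 2 * (1 - f x) / (2 * k x ^ 2) := by
            have h6 : 0 ≤ 1 + f x := by linarith
            have h7 : 0 ≤ 1 - f x := by linarith
            positivity
          have e3 : -(a / 2) * s ^ 2 - (1 + f x) / k x ^ 2 * (-a * x ^ 2) =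
              a * (1 + f x) * x ^ 2 * (1 - f x) / (2 * k x ^ 2) := by
            rw [e1]; field_simp; ring
          linarith
  have hgain : ∀ s l, |s| ≤ R → 0 ≤ l → l ≤ 1 →
      k (e.symm s) + a / 4 * (s ^ 2 * (1 - l ^ 2)) ≤ k (e.symm (l * s)) := by
    intro s l hs hl0 hl1
    have hls : ∀ l, l ∈ Icc (0 : ℝ) 1 → |l * s| ≤ R := fun l hl => by
      rw [abs_mul, abs_of_nonneg hl.1]
      exact (mul_le_of_le_one_left (abs_nonneg _) hl.2).trans hs
    have hder : ∀ l ∈ Icc (0 : ℝ) 1, HasDerivAt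
        (fun l => k (e.symm (l * s)) + a / 4 * (s ^ 2 * l ^ 2))
        (k' (e.symm (l * s)) * (k (e.symm (l * s)))⁻¹ * s + a / 4 * (s ^ 2 * (2 * l))) l := by
      intro l hl
      refine HasDerivAt.add ?_ ?_
      · simpa [Function.comp_def] using HasDerivAt.comp l (hkd _ (hls l hl)) ((hasDerivAt_id l).mul_const s)
      · simpa using ((hasDerivAt_pow 2 l).const_mul (s ^ 2)).const_mul (a / 4)
    have hanti : AntitoneOn (fun l => k (e.symm (l * s)) + a / 4 * (s ^ 2 * l ^ 2)) (Icc 0 1) := by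
      refine antitoneOn_of_hasDerivWithinAt_nonpos (convex_Icc 0 1)
        (fun l hl => (hder l hl).continuousAt.continuousWithinAt)
        (fun l hl => (hder l (interior_subset hl)).hasDerivWithinAt) fun l hl => ?_
      have h1 := hsign _ (hls l (interior_subset hl))
      rw [interior_Icc] at hl
      refine nonpos_of_mul_nonpos_right (a := l) ?_ hl.1
      linarith
    have := hanti ⟨hl0, hl1⟩ ⟨zero_le_one, le_rfl⟩ hl1
    simp only [one_mul, one_pow, mul_one] at this
    linarith
  have hle1 : ∀ s, |s| ≤ R → k (e.symm s) ≤ 1 := fun s hs => by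
    have := hgain s 0 hs le_rfl zero_le_one
    rw [zero_mul, hX0, hk0] at this
    nlinarith [sq_nonneg s]
  have hcl : ∀ s : ℝ, |max (-R) (min s R)| ≤ R := fun s => by
    rw [abs_le]
    exact ⟨le_max_left _ _, max_le (by linarith) (min_le_right _ _)⟩
  have hcl' : ∀ s : ℝ, |s| ≤ R → max (-R) (min s R) = s := fun s hs => by
    rw [min_eq_left (le_of_abs_le hs), max_eq_right (neg_le_of_abs_le hs)]
  have hlip : ∀ s, |s| ≤ R → ∀ t, |t| ≤ R →
      |k (e.symm t) - k (e.symm s)| ≤ 4 * a * |t - s| := by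
    intro s hs t ht
    refine Convex.norm_image_sub_le_of_norm_hasDerivWithin_le (s := Icc (-R) R)
      (f := fun s => k (e.symm s)) (f' := fun s => k' (e.symm s) * (k (e.symm s))⁻¹)
      (fun u hu => (hkd u (abs_le.2 hu)).hasDerivWithinAt) (fun u hu => ?_) (convex_Icc _ _)
      (abs_le.1 hs) (abs_le.1 ht)
    obtain ⟨⟨⟨-, -, -, -, h2⟩, h3, -, -, h4, -⟩, -⟩ := H u (abs_le.2 hu)
    rw [norm_mul, norm_inv, Real.norm_eq_abs, Real.norm_eq_abs,
      abs_of_pos (show 0 < k (e.symm u) by linarith), ← div_eq_mul_inv,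
      div_le_iff₀ (by linarith)]
    nlinarith [abs_nonneg (e.symm u)]
  refine ⟨R, e.symm, fun s => k (e.symm (max (-R) (min s R))), ⟨?_, ?_, ?_, ?_, ?_, ?_, ?_, ?_, ?_⟩,
    ?_⟩
  · intro s hs
    simp only [hcl' s hs]
    exact hXd s hs
  · intro s hs
    simp only [hcl' s hs]
    rw [← (H s hs).1.1.2.1, hSX s hs, mul_comm]
  · intro s hs
    exact contDiffAt_id.mul (contDiffAt_const.add ((H s hs).1.2.2.2.2.2.of_le (by norm_num)))
  · refine ⟨⟨4 * a, by positivity⟩, LipschitzWith.of_dist_le_mul fun s t => ?_⟩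
    rw [Real.dist_eq, Real.dist_eq]
    refine (hlip _ (hcl t) _ (hcl s)).trans ?_
    have h1 := abs_max_sub_max_le_max (-R) (min s R) (-R) (min t R)
    have h2 := abs_min_sub_min_le_max s R t R
    exact mul_le_mul_of_nonneg_left ((h1.trans (by simp)).trans (h2.trans (by simp)))
      (by positivity)
  · intro s
    exact (H _ (hcl s)).1.2.1.le
  · intro s
    exact hle1 _ (hcl s)
  · have := hcl' 0 (by simpa using hRpos.le)
    simp only [this, hX0, hk0]
  · positivity
  · intro s l hs hl0 hl1
    have : |l * s| ≤ R := by
      rw [abs_mul, abs_of_nonneg hl0]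
      exact (mul_le_of_le_one_left (abs_nonneg _) hl1).trans hs
    simp only [hcl' s hs, hcl' _ this]
    exact hgain s l hs hl0 hl1
  · have hSt : Tendsto S (𝓝 0) (𝓝 0) := by
      have := hev.self_of_nhds.1.continuousAt.tendsto
      rwa [hS0] at this
    obtain ⟨δ, hδ, hd⟩ := Metric.eventually_nhds_iff.1
      (((hSt.eventually_lt_const hRpos).and hgood).and (e.open_source.mem_nhds hsrc))
    refine ⟨δ, hδ, fun x₀ hx₀ hx₀δ => ⟨S x₀, ?_, ?_, e.left_inv ?_⟩⟩
    all_goals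
      obtain ⟨⟨h1, ⟨-, h2, -⟩, h3, h4, -⟩, h5⟩ :=
        @hd x₀ (by rwa [Real.dist_eq, sub_zero, abs_of_pos hx₀])
    · have : 0 < S x₀ * k x₀ := by
        rw [h2]
        exact mul_pos hx₀ (by linarith)
      exact pos_of_mul_pos_left this (by linarith)
    · exact h1.le
    · exact h5

/-- The undamped rotation with angular speed `h`, perturbed by a linear damping `2 α v`, in the polar
coordinates `s = s₀ e ^ (-q) cos θ`, `v = -s₀ e ^ (-q) sin θ`. -/
structure IsPhaseMotion (h : ℝ → ℝ) (s₀ α : ℝ) (q θ : ℝ → ℝ) : Prop where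
  q_zero : q 0 = 0
  angle_zero : θ 0 = 0
  hasDerivAt_q : ∀ t, 0 ≤ t → HasDerivAt q (α * (1 - Real.cos (2 * θ t))) t
  hasDerivAt_angle : ∀ t, 0 ≤ t →
    HasDerivAt θ (h (s₀ * Real.exp (-q t) * Real.cos (θ t)) - α * Real.sin (2 * θ t)) t

theorem add_mul_le_of_le_deriv {u u' : ℝ → ℝ} {a b m : ℝ} (hab : a ≤ b)
    (hu : ∀ t ∈ Icc a b, HasDerivAt u (u' t) t) (hm : ∀ t ∈ Icc a b, m ≤ u' t) :
    u a + m * (b - a) ≤ u b := by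
  have := (convex_Icc a b).mul_sub_le_image_sub_of_le_deriv (f := u) (C := m)
    (fun t ht => (hu t ht).continuousAt.continuousWithinAt)
    (fun t ht => (hu t (interior_subset ht)).differentiableAt.differentiableWithinAt)
    (fun t ht => by rw [(hu t (interior_subset ht)).deriv]; exact hm t (interior_subset ht))
    a ⟨le_rfl, hab⟩ b ⟨hab, le_rfl⟩ hab
  linarith

theorem abs_exp_neg_sub_exp_neg_le {x y : ℝ} (hx : 0 ≤ x) (hy : 0 ≤ y) :
    |Real.exp (-x) - Real.exp (-y)| ≤ |x - y| := by
  have := Convex.norm_image_sub_le_of_norm_hasDerivWithin_le (s := Ici (0 : ℝ)) (C := 1)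
      (f := fun s => Real.exp (-s)) (f' := fun s => Real.exp (-s) * (-1))
      (fun u _ => ((hasDerivAt_neg u).exp).hasDerivWithinAt) (fun u hu => by
        rw [norm_mul, norm_neg, norm_one, mul_one, Real.norm_eq_abs, Real.abs_exp, Real.exp_le_one_iff]
        simpa using hu) (convex_Ici 0) hy hx
  simpa using this

theorem abs_sin_two_mul_sub_le (x y : ℝ) : |Real.sin (2 * x) - Real.sin (2 * y)| ≤ 2 * |x - y| := by
  have := Real.lipschitzWith_sin.dist_le_mul (2 * x) (2 * y)
  rwa [NNReal.coe_one, one_mul, Real.dist_eq, Real.dist_eq, ← mul_sub, abs_mul, abs_two] at this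

theorem abs_cos_two_mul_sub_le (x y : ℝ) : |Real.cos (2 * x) - Real.cos (2 * y)| ≤ 2 * |x - y| := by
  have := Real.lipschitzWith_cos.dist_le_mul (2 * x) (2 * y)
  rwa [NNReal.coe_one, one_mul, Real.dist_eq, Real.dist_eq, ← mul_sub, abs_mul, abs_two] at this

/-- The vector field of `IsPhaseMotion`, frozen for `q ≤ 0` so as to be globally Lipschitz. -/
noncomputable def phaseField (h : ℝ → ℝ) (s₀ α : ℝ) (z : ℝ × ℝ) : ℝ × ℝ :=
  (α * (1 - Real.cos (2 * z.2)),
    h (s₀ * Real.exp (-max z.1 0) * Real.cos z.2) - α * Real.sin (2 * z.2))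

theorem lipschitzWith_phaseField {h : ℝ → ℝ} {K : NNReal} (hh : LipschitzWith K h) {s₀ α : ℝ}
    (hs : 0 < s₀) (hα : α ∈ Icc (0 : ℝ) 1) :
    LipschitzWith (K * (s₀.toNNReal * 2) + 2) (phaseField h s₀ α) := by
  refine LipschitzWith.of_dist_le_mul fun z w => ?_
  have hd1 : |z.1 - w.1| ≤ dist z w := by rw [Prod.dist_eq, ← Real.dist_eq]; exact le_max_left _ _
  have hd2 : |z.2 - w.2| ≤ dist z w := by rw [Prod.dist_eq, ← Real.dist_eq]; exact le_max_right _ _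
  generalize dist z w = d at *
  have hd : 0 ≤ d := (abs_nonneg _).trans hd1
  have hK : 0 ≤ (K : ℝ) := K.2
  have hKs : 0 ≤ (K : ℝ) * (s₀ * 2) * d := by positivity
  rw [Prod.dist_eq, Real.dist_eq, Real.dist_eq]
  push_cast
  rw [Real.coe_toNNReal _ hs.le]
  simp only [phaseField]
  refine max_le ?_ ?_
  · have h1 := abs_cos_two_mul_sub_le z.2 w.2
    rw [← mul_sub, abs_mul, abs_of_nonneg hα.1, sub_sub_sub_cancel_left, abs_sub_comm]
    have := mul_le_mul hα.2 h1 (abs_nonneg _) zero_le_one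
    linarith
  · have h1 := abs_sin_two_mul_sub_le z.2 w.2
    have h2 : α * |Real.sin (2 * z.2) - Real.sin (2 * w.2)| ≤ 1 * (2 * |z.2 - w.2|) :=
      mul_le_mul hα.2 h1 (abs_nonneg _) zero_le_one
    have h3 := hh.dist_le_mul (s₀ * Real.exp (-max z.1 0) * Real.cos z.2)
      (s₀ * Real.exp (-max w.1 0) * Real.cos w.2)
    rw [Real.dist_eq, Real.dist_eq] at h3
    have h4 : |Real.exp (-max z.1 0) - Real.exp (-max w.1 0)| ≤ d :=
      (abs_exp_neg_sub_exp_neg_le (le_max_right _ _) (le_max_right _ _)).trans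
        ((abs_max_sub_max_le_max z.1 0 w.1 0).trans (by rw [sub_self, abs_zero]; exact max_le hd1 hd))
    have h5 : |Real.cos z.2 - Real.cos w.2| ≤ d := by
      have := Real.lipschitzWith_cos.dist_le_mul z.2 w.2
      rw [NNReal.coe_one, one_mul, Real.dist_eq, Real.dist_eq] at this
      exact this.trans hd2
    have h6 : |s₀ * Real.exp (-max z.1 0) * Real.cos z.2 -
        s₀ * Real.exp (-max w.1 0) * Real.cos w.2| ≤ s₀ * 2 * d := by
      have e1 : s₀ * Real.exp (-max z.1 0) * Real.cos z.2 -
        s₀ * Real.exp (-max w.1 0) * Real.cos w.2 =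
        s₀ * ((Real.exp (-max z.1 0) - Real.exp (-max w.1 0)) * Real.cos z.2 +
          Real.exp (-max w.1 0) * (Real.cos z.2 - Real.cos w.2)) := by ring
      have e2 : Real.exp (-max w.1 0) ≤ 1 := by simp
      have e3 : |(Real.exp (-max z.1 0) - Real.exp (-max w.1 0)) * Real.cos z.2| ≤ d * 1 := by
        rw [abs_mul]
        exact mul_le_mul h4 (Real.abs_cos_le_one _) (abs_nonneg _) hd
      have e4 : |Real.exp (-max w.1 0) * (Real.cos z.2 - Real.cos w.2)| ≤ 1 * d := by
        rw [abs_mul, Real.abs_exp]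
        exact mul_le_mul e2 h5 (abs_nonneg _) zero_le_one
      rw [e1, abs_mul, abs_of_pos hs, mul_assoc]
      refine mul_le_mul_of_nonneg_left ((abs_add_le _ _).trans ?_) hs.le
      linarith
    have h7 := mul_le_mul_of_nonneg_left h6 hK
    have e5 := abs_sub (h (s₀ * Real.exp (-max z.1 0) * Real.cos z.2) -
      h (s₀ * Real.exp (-max w.1 0) * Real.cos w.2))
      (α * (Real.sin (2 * z.2) - Real.sin (2 * w.2)))
    rw [abs_mul α, abs_of_nonneg hα.1] at e5
    rw [sub_sub_sub_comm, ← mul_sub]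
    linarith

theorem norm_phaseField_le {h : ℝ → ℝ} (h0 : ∀ s, 1 / 2 ≤ h s) (h1 : ∀ s, h s ≤ 1) {s₀ α : ℝ}
    (hα : α ∈ Icc (0 : ℝ) 1) (z : ℝ × ℝ) : ‖phaseField h s₀ α z‖ ≤ 2 := by
  obtain ⟨hα0, hα1⟩ := hα
  rw [Prod.norm_def, Real.norm_eq_abs, Real.norm_eq_abs]
  simp only [phaseField]
  have a1 := Real.neg_one_le_cos (2 * z.2)
  have a2 := Real.cos_le_one (2 * z.2)
  have a3 := Real.neg_one_le_sin (2 * z.2)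
  have a4 := Real.sin_le_one (2 * z.2)
  have a5 := h0 (s₀ * Real.exp (-max z.1 0) * Real.cos z.2)
  have a6 := h1 (s₀ * Real.exp (-max z.1 0) * Real.cos z.2)
  refine max_le ?_ ?_ <;> rw [abs_le] <;> constructor <;> nlinarith

namespace IsPhaseMotion

variable {h : ℝ → ℝ} {s₀ α : ℝ} {q θ : ℝ → ℝ}

theorem q_nonneg (H : IsPhaseMotion h s₀ α q θ) (hα : 0 ≤ α) {t : ℝ} (ht : 0 ≤ t) : 0 ≤ q t := by
  have := add_mul_le_of_le_deriv (m := 0) ht (fun s hs => H.hasDerivAt_q s hs.1) fun s _ =>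
    mul_nonneg hα (by linarith [Real.cos_le_one (2 * θ s)])
  rw [H.q_zero] at this
  linarith

theorem hasDerivAt_prod (H : IsPhaseMotion h s₀ α q θ) (hα : 0 ≤ α) {t : ℝ} (ht : 0 ≤ t) :
    HasDerivAt (fun t => (q t, θ t)) (phaseField h s₀ α (q t, θ t)) t := by
  have := (H.hasDerivAt_q t ht).prodMk (H.hasDerivAt_angle t ht)
  simpa only [phaseField, max_eq_left (H.q_nonneg hα ht)] using this

theorem exists_of_lipschitzWith {K : NNReal} (hh : LipschitzWith K h) (h0 : ∀ s, 1 / 2 ≤ h s)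
    (h1 : ∀ s, h s ≤ 1) (hs : 0 < s₀) (hα : α ∈ Icc (0 : ℝ) 1) :
    ∃ q θ, IsPhaseMotion h s₀ α q θ := by
  obtain ⟨u, hu0, hu⟩ := exists_forall_hasDerivAt_of_lipschitzWith_of_bounded (M := 2)
    (lipschitzWith_phaseField hh hs hα) (norm_phaseField_le h0 h1 hα) 0
  have hq : ∀ t, HasDerivAt (fun t => (u t).1) (α * (1 - Real.cos (2 * (u t).2))) t := fun t =>
    (hu t).fst
  have hθ : ∀ t, HasDerivAt (fun t => (u t).2) (phaseField h s₀ α (u t)).2 t := fun t =>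
    (hu t).snd
  have hnn : ∀ t, 0 ≤ t → 0 ≤ (u t).1 := fun t ht => by
    have := add_mul_le_of_le_deriv (m := 0) ht (fun s _ => hq s) fun s _ =>
      mul_nonneg hα.1 (by linarith [Real.cos_le_one (2 * (u s).2)])
    simp only [hu0, Prod.fst_zero] at this
    linarith
  refine ⟨fun t => (u t).1, fun t => (u t).2, by simp [hu0], by simp [hu0], fun t _ => hq t,
    fun t ht => ?_⟩
  have := hθ t
  simpa only [phaseField, max_eq_left (hnn t ht)] using this

theorem eventually_abs_sub_lt {K : NNReal} (hh : LipschitzWith K h) (hs : 0 < s₀)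
    (hα : α ∈ Icc (0 : ℝ) 1) (H : IsPhaseMotion h s₀ α q θ) {T ε : ℝ} (hε : 0 < ε) :
    ∀ᶠ β in 𝓝 α, β ∈ Icc (0 : ℝ) 1 → ∀ q' θ', IsPhaseMotion h s₀ β q' θ' →
      ∀ t ∈ Icc 0 T, |θ' t - θ t| < ε := by
  set L : NNReal := K * (s₀.toNNReal * 2) + 2 with hL
  have hlim : Tendsto (fun β => gronwallBound 0 L (2 * |β - α| + 0) T) (𝓝 α) (𝓝 0) := by
    have h1 : Continuous fun β => gronwallBound 0 L (2 * |β - α| + 0) T :=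
      (gronwallBound_continuous_ε 0 L T).comp (by fun_prop)
    have := h1.tendsto α
    simpa [gronwallBound_ε0_δ0] using this
  filter_upwards [hlim.eventually_lt_const hε] with β hβ hβI q' θ' H' t ht
  have hg := dist_le_of_approx_trajectories_ODE (v := fun _ => phaseField h s₀ α) (K := L)
    (f := fun t => (q' t, θ' t)) (g := fun t => (q t, θ t))
    (f' := fun t => phaseField h s₀ β (q' t, θ' t)) (g' := fun t => phaseField h s₀ α (q t, θ t))
    (a := 0) (b := T) (δ := 0) (εf := 2 * |β - α|) (εg := 0)
    (fun t => lipschitzWith_phaseField hh hs hα)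
    (fun t ht => (H'.hasDerivAt_prod hβI.1 ht.1).continuousAt.continuousWithinAt)
    (fun t ht => (H'.hasDerivAt_prod hβI.1 ht.1).hasDerivWithinAt)
    (fun t ht => by
      rw [Prod.dist_eq, Real.dist_eq, Real.dist_eq]
      simp only [phaseField]
      refine max_le ?_ ?_
      · rw [← sub_mul, abs_mul, mul_comm]
        refine mul_le_mul_of_nonneg_right ?_ (abs_nonneg _)
        rw [abs_le]
        constructor <;> linarith [Real.neg_one_le_cos (2 * θ' t), Real.cos_le_one (2 * θ' t)]
      · rw [sub_sub_sub_cancel_left, ← sub_mul, abs_mul, mul_comm, abs_sub_comm α]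
        refine mul_le_mul_of_nonneg_right ?_ (abs_nonneg _)
        linarith [Real.abs_sin_le_one (2 * θ' t)])
    (fun t ht => (H.hasDerivAt_prod hα.1 ht.1).continuousAt.continuousWithinAt)
    (fun t ht => (H.hasDerivAt_prod hα.1 ht.1).hasDerivWithinAt)
    (fun t ht => by simp)
    (by simp [H.q_zero, H.angle_zero, H'.q_zero, H'.angle_zero]) t ht
  have hmono := gronwallBound_mono (δ := 0) (K := L) (ε := 2 * |β - α| + 0) le_rfl (by positivity)
    L.2 (show t - 0 ≤ T by linarith [ht.2])
  refine lt_of_le_of_lt ?_ hβ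
  refine le_trans ?_ (hg.trans hmono)
  rw [Prod.dist_eq, ← Real.dist_eq]
  exact le_max_right _ _

theorem angle_pos (H : IsPhaseMotion h s₀ α q θ) (h0 : ∀ s, 1 / 2 ≤ h s) {t : ℝ} (ht : 0 < t) :
    0 < θ t := by
  refine pos_of_deriv_pos_of_eq_zero (a := 0) H.hasDerivAt_angle H.angle_zero.ge
    (fun t _ hz => ?_) ht
  rw [hz]
  simp only [mul_zero, Real.sin_zero, sub_zero]
  linarith [h0 (s₀ * Real.exp (-q t) * Real.cos 0)]

theorem continuousOn_angle (H : IsPhaseMotion h s₀ α q θ) (T : ℝ) : ContinuousOn θ (Icc 0 T) :=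
  fun t ht => (H.hasDerivAt_angle t ht.1).continuousAt.continuousWithinAt

theorem exists_angle_eq (H : IsPhaseMotion h s₀ α q θ) {T y : ℝ} (hT : 0 ≤ T) (hy : 0 ≤ y)
    (hyT : y ≤ θ T) : ∃ t ∈ Icc 0 T, θ t = y := by
  have := intermediate_value_Icc hT (H.continuousOn_angle T)
  rw [H.angle_zero] at this
  exact this ⟨hy, hyT⟩

theorem abs_amplitude_le (H : IsPhaseMotion h s₀ α q θ) (hs : 0 ≤ s₀) (hα : 0 ≤ α) {t : ℝ}
    (ht : 0 ≤ t) : |s₀ * Real.exp (-q t) * Real.cos (θ t)| ≤ s₀ := by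
  rw [abs_mul, abs_of_nonneg (by positivity)]
  have h1 : Real.exp (-q t) ≤ 1 := by simpa using H.q_nonneg hα ht
  calc s₀ * Real.exp (-q t) * |Real.cos (θ t)| ≤ s₀ * 1 * 1 := by
        gcongr
        exact Real.abs_cos_le_one _
    _ = s₀ := by ring

/-- An underdamped motion performs a full turn. -/
theorem exists_full_turn {K : NNReal} (hh : LipschitzWith K h) (h0 : ∀ s, 1 / 2 ≤ h s)
    (hh1 : h 0 = 1) (hα0 : 0 ≤ α) (hα1 : α < 1)
    (H : IsPhaseMotion h s₀ α q θ) : ∃ t, 0 ≤ t ∧ θ t = 2 * Real.pi := by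
  by_contra! hcon
  have hlt : ∀ t, 0 ≤ t → θ t < 2 * Real.pi := by
    intro t ht
    by_contra! hge
    obtain ⟨s, hs, hs'⟩ := H.exists_angle_eq ht (by positivity) hge
    exact hcon s hs.1 hs'
  have hq : ∀ t, 0 ≤ t → t / 8 - Real.pi ≤ q t := by
    intro t ht
    have := add_mul_le_of_le_deriv (u := fun t => θ t + 2 * q t) (m := 1 / 4) ht
      (fun s hs => (H.hasDerivAt_angle s hs.1).add ((H.hasDerivAt_q s hs.1).const_mul 2))
      (fun s hs => by
        have a1 := h0 (s₀ * Real.exp (-q s) * Real.cos (θ s))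
        rw [Real.sin_two_mul, Real.cos_two_mul]
        have a2 := Real.sin_sq_add_cos_sq (θ s)
        generalize Real.sin (θ s) = y at *
        generalize Real.cos (θ s) = x at *
        have a3 : 2 * y * x - 2 * (1 - (2 * x ^ 2 - 1)) ≤ 1 / 4 := by
          nlinarith [sq_nonneg (2 * y - x / 2)]
        nlinarith [mul_le_mul_of_nonneg_left a3 hα0])
    simp only [H.angle_zero, H.q_zero] at this
    linarith [hlt t ht]
  have hexp : Tendsto (fun t => s₀ * Real.exp (-q t) * Real.cos (θ t)) atTop (𝓝 0) := by
    have hqt : Tendsto q atTop atTop := by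
      refine tendsto_atTop_mono' _ ?_
        (tendsto_atTop_add_const_right _ (-Real.pi) (tendsto_id.atTop_div_const (show (0 : ℝ) < 8 by norm_num)))
      filter_upwards [eventually_ge_atTop 0] with t ht
      exact hq t ht
    have h1 : Tendsto (fun t => s₀ * Real.exp (-q t)) atTop (𝓝 0) := by
      simpa using (Real.tendsto_exp_neg_atTop_nhds_zero.comp hqt).const_mul s₀
    exact h1.zero_mul_isBoundedUnder_le
      (isBoundedUnder_of ⟨1, fun t => by simpa using Real.abs_cos_le_one (θ t)⟩)
  have hht := (hh.continuous.tendsto 0).comp hexp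
  rw [hh1] at hht
  obtain ⟨T, hT⟩ := eventually_atTop.1
    (hht.eventually_const_lt (show (1 + α) / 2 < 1 by linarith))
  set T₀ := max T 0 with hT₀
  set m := (1 - α) / 2 with hm
  have hmpos : 0 < m := by simp only [hm]; linarith
  have hlin := add_mul_le_of_le_deriv (u := θ) (m := m) (a := T₀) (b := T₀ + 2 * Real.pi / m)
    (by have : 0 ≤ 2 * Real.pi / m := by positivity
        linarith)
    (fun s hs => H.hasDerivAt_angle s ((le_max_right _ _).trans hs.1))
    (fun s hs => by
      have a1 := hT s ((le_max_left _ _).trans hs.1)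
      simp only [Function.comp] at a1
      have a2 := mul_le_mul_of_nonneg_left (Real.sin_le_one (2 * θ s)) hα0
      simp only [hm]
      linarith)
  have hb : 0 ≤ T₀ + 2 * Real.pi / m := by
    have : 0 ≤ T₀ := le_max_right _ _
    positivity
  have h2 := hlt _ hb
  have h3 : 0 ≤ θ T₀ := by
    rcases (le_max_right T 0).eq_or_lt with h | h
    · rw [hT₀, ← h, H.angle_zero]
    · exact (H.angle_pos h0 h).le
  rw [add_sub_cancel_left, mul_div_cancel₀ _ hmpos.ne'] at hlin
  linarith

end IsPhaseMotion

/-- The time which a motion with constant amplitude `s₀` and angular speed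
`h (s₀ cos θ) - α sin (2 θ)` needs to turn by the angle `y`. -/
noncomputable def turnTime (h : ℝ → ℝ) (s₀ α y : ℝ) : ℝ :=
  ∫ φ in (0 : ℝ)..y, (h (s₀ * Real.cos φ) - α * Real.sin (2 * φ))⁻¹

section TurnTime
variable {h : ℝ → ℝ} {s₀ α : ℝ}

theorem speed_lower_bound (h0 : ∀ s, 1 / 2 ≤ h s) (hα : α ∈ Icc (0 : ℝ) (1 / 8)) (y : ℝ) :
    1 / 4 ≤ h (s₀ * Real.cos y) - α * Real.sin (2 * y) := by
  have h1 := h0 (s₀ * Real.cos y)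
  nlinarith [Real.sin_le_one (2 * y), hα.1, hα.2]

theorem hasDerivAt_turnTime (hc : Continuous h) (h0 : ∀ s, 1 / 2 ≤ h s)
    (hα : α ∈ Icc (0 : ℝ) (1 / 8)) (y : ℝ) :
    HasDerivAt (turnTime h s₀ α) (h (s₀ * Real.cos y) - α * Real.sin (2 * y))⁻¹ y := by
  have : Continuous fun φ => (h (s₀ * Real.cos φ) - α * Real.sin (2 * φ))⁻¹ := by
    refine Continuous.inv₀ (by fun_prop) fun y => ?_
    linarith [speed_lower_bound (s₀ := s₀) h0 hα y]
  exact (this.integral_hasStrictDerivAt 0 y).hasDerivAt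

theorem turnTime_two_pi_le (hc : Continuous h) (h0 : ∀ s, 1 / 2 ≤ h s)
    (hα : α ∈ Icc (0 : ℝ) (1 / 8)) :
    turnTime h s₀ α (2 * Real.pi) ≤ turnTime h s₀ 0 (2 * Real.pi) + 32 * Real.pi * α ^ 2 := by
  have hpos : ∀ s, 0 < h s := fun s => by linarith [h0 s]
  have hodd : ∫ φ in (0 : ℝ)..(2 * Real.pi), Real.sin (2 * φ) / h (s₀ * Real.cos φ) ^ 2 = 0 := by
    have := intervalIntegral.integral_comp_sub_left
      (fun φ => Real.sin (2 * φ) / h (s₀ * Real.cos φ) ^ 2) (a := 0) (b := 2 * Real.pi)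
      (2 * Real.pi)
    rw [sub_self, sub_zero] at this
    have h2 : ∀ φ, Real.sin (2 * (2 * Real.pi - φ)) / h (s₀ * Real.cos (2 * Real.pi - φ)) ^ 2 =
        -(Real.sin (2 * φ) / h (s₀ * Real.cos φ) ^ 2) := fun φ => by
      rw [Real.cos_two_pi_sub, Real.sin_two_mul, Real.sin_two_mul, Real.cos_two_pi_sub,
        Real.sin_two_pi_sub]
      ring
    simp only [h2, intervalIntegral.integral_neg] at this
    linarith
  have hcont : Continuous fun φ => Real.sin (2 * φ) / h (s₀ * Real.cos φ) ^ 2 :=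
    Continuous.div (by fun_prop) (by fun_prop) fun φ => (pow_pos (hpos _) 2).ne'
  have hcont0 : Continuous fun φ => (h (s₀ * Real.cos φ) - 0 * Real.sin (2 * φ))⁻¹ :=
    Continuous.inv₀ (by fun_prop) fun φ => by
      rw [zero_mul, sub_zero]; exact (hpos _).ne'
  have hcontα : Continuous fun φ => (h (s₀ * Real.cos φ) - α * Real.sin (2 * φ))⁻¹ :=
    Continuous.inv₀ (by fun_prop) fun φ => by
      linarith [speed_lower_bound (s₀ := s₀) h0 hα φ]
  have hle : turnTime h s₀ α (2 * Real.pi) ≤ ∫ φ in (0 : ℝ)..(2 * Real.pi),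
      ((h (s₀ * Real.cos φ) - 0 * Real.sin (2 * φ))⁻¹ +
        α * (Real.sin (2 * φ) / h (s₀ * Real.cos φ) ^ 2) + 16 * α ^ 2) := by
    refine intervalIntegral.integral_mono_on (by positivity) (hcontα.intervalIntegrable _ _)
      (((hcont0.add (hcont.const_mul α)).add continuous_const).intervalIntegrable _ _)
      fun φ _ => ?_
    have h1 := speed_lower_bound (s₀ := s₀) h0 hα φ
    have h2 := h0 (s₀ * Real.cos φ)
    have h3 : Real.sin (2 * φ) ^ 2 ≤ 1 := Real.sin_sq_le_one _
    rw [zero_mul, sub_zero]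
    generalize h (s₀ * Real.cos φ) = w at *
    generalize Real.sin (2 * φ) = z at *
    have hw : 0 < w := by linarith
    have hd : 0 < w - α * z := by linarith
    have e1 : (w - α * z)⁻¹ = w⁻¹ + α * (z / w ^ 2) + α ^ 2 * (z ^ 2 / (w ^ 2 * (w - α * z))) := by
      field_simp
      ring
    rw [e1]
    have e2 : z ^ 2 / (w ^ 2 * (w - α * z)) ≤ 16 := by
      rw [div_le_iff₀ (by positivity)]
      have h5 : (1 / 2) ^ 2 * (1 / 4) ≤ w ^ 2 * (w - α * z) := by gcongr
      linarith
    nlinarith [sq_nonneg α]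
  refine hle.trans ?_
  rw [intervalIntegral.integral_add, intervalIntegral.integral_add,
    intervalIntegral.integral_const_mul, hodd, intervalIntegral.integral_const, turnTime]
  · simp only [smul_eq_mul]
    linarith
  · exact hcont0.intervalIntegrable _ _
  · exact (hcont.const_mul α).intervalIntegrable _ _
  · exact (hcont0.add (hcont.const_mul α)).intervalIntegrable _ _
  · exact continuous_const.intervalIntegrable _ _

end TurnTime

namespace IsPhaseMotion
variable {h : ℝ → ℝ} {s₀ α : ℝ} {q θ : ℝ → ℝ}

theorem turnTime_angle_of_undamped (H : IsPhaseMotion h s₀ 0 q θ) (hc : Continuous h)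
    (h0 : ∀ s, 1 / 2 ≤ h s) {t : ℝ} (ht : 0 ≤ t) : turnTime h s₀ 0 (θ t) = t := by
  have hq : ∀ t, 0 ≤ t → q t = 0 := by
    intro t ht
    have h1 := add_mul_le_of_le_deriv (m := 0) ht (fun s hs => H.hasDerivAt_q s hs.1)
      fun s _ => by simp
    have h2 := add_mul_le_of_le_deriv (m := 0) ht (fun s hs => (H.hasDerivAt_q s hs.1).neg)
      fun s _ => by simp
    simp only [Pi.neg_apply, H.q_zero] at h1 h2
    linarith
  have hd : ∀ t, 0 ≤ t → HasDerivAt (fun t => turnTime h s₀ 0 (θ t)) 1 t := by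
    intro t ht
    have hα : (0 : ℝ) ∈ Icc (0 : ℝ) (1 / 8) := by norm_num
    refine ((hasDerivAt_turnTime (s₀ := s₀) hc h0 hα (θ t)).comp t
      (H.hasDerivAt_angle t ht)).congr_deriv ?_
    rw [hq t ht]
    simp only [neg_zero, Real.exp_zero, mul_one]
    refine inv_mul_cancel₀ ?_
    linarith [speed_lower_bound (s₀ := s₀) h0 hα (θ t)]
  have h1 := add_mul_le_of_le_deriv (m := 1) ht (fun s hs => hd s hs.1) fun s _ => le_rfl
  have h2 := add_mul_le_of_le_deriv (m := -1) ht (fun s hs => (hd s hs.1).neg) fun s _ => le_rfl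
  simp only [Pi.neg_apply, H.angle_zero] at h1 h2
  have h3 : turnTime h s₀ 0 0 = 0 := by simp [turnTime]
  linarith

/-- The decay of the amplitude speeds up the rotation: to first order in the damping, the motion
gains time over the one with constant amplitude. -/
theorem add_le_turnTime {c : ℝ} (H : IsPhaseMotion h s₀ α q θ) (hc : Continuous h)
    (h0 : ∀ s, 1 / 2 ≤ h s) (h1 : ∀ s, h s ≤ 1) (hα : α ∈ Icc (0 : ℝ) (1 / 8)) (hs₀ : 0 ≤ s₀)
    (hc0 : 0 ≤ c) (hgain : ∀ s l, |s| ≤ s₀ → 0 ≤ l → l ≤ 1 →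
      h s + c * (s ^ 2 * (1 - l ^ 2)) ≤ h (l * s)) {T : ℝ} (hT : 0 ≤ T)
    (hθT : ∀ t ∈ Icc 0 T, θ t ≤ 2 * Real.pi) (hT2 : θ T = 2 * Real.pi) :
    T + c * s₀ ^ 2 / 4 * α * (Real.pi ^ 2 / 2) ≤ turnTime h s₀ α (2 * Real.pi) := by
  have hθ0 : ∀ t, 0 ≤ t → 0 ≤ θ t := fun t ht => by
    rcases ht.eq_or_lt with rfl | ht
    · exact H.angle_zero.ge
    · exact (H.angle_pos h0 ht).le
  have hα0 := hα.1
  have hα1 := hα.2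
  have hspeed : ∀ t, h (s₀ * Real.exp (-q t) * Real.cos (θ t)) - α * Real.sin (2 * θ t) ≤ 2 :=
    fun t => by
      nlinarith [h1 (s₀ * Real.exp (-q t) * Real.cos (θ t)), Real.neg_one_le_sin (2 * θ t)]
  have hp0 : ∀ y : ℝ, 0 ≤ y → 0 ≤ y / 2 - Real.sin (2 * y) / 4 := fun y hy => by
    have := Real.sin_le (show 0 ≤ 2 * y by linarith)
    linarith
  have hsin2 : ∀ y : ℝ, HasDerivAt (fun y => Real.sin (2 * y)) (2 * Real.cos (2 * y)) y := fun y => by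
    simpa [mul_comm] using ((hasDerivAt_id y).const_mul 2).sin
  have hcos2 : ∀ y : ℝ, HasDerivAt (fun y => Real.cos (2 * y)) (-(2 * Real.sin (2 * y))) y :=
    fun y => by
      simpa [mul_comm] using ((hasDerivAt_id y).const_mul 2).cos
  have hp : ∀ y : ℝ, HasDerivAt (fun y => y / 2 - Real.sin (2 * y) / 4)
      (1 / 2 - 2 * Real.cos (2 * y) / 4) y := fun y =>
    ((hasDerivAt_id y).div_const 2).sub ((hsin2 y).div_const 4)
  have hQ : ∀ y : ℝ, HasDerivAt (fun y => y ^ 2 / 8 + y * Real.sin (2 * y) / 8 +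
      Real.cos (2 * y) / 8 + Real.cos (2 * y) ^ 2 / 32)
      (Real.cos y ^ 2 * (y / 2 - Real.sin (2 * y) / 4)) y := fun y => by
    refine (((((hasDerivAt_pow 2 y).div_const 8).add (((hasDerivAt_id y).mul (hsin2 y)).div_const
      8)).add ((hcos2 y).div_const 8)).add (((hcos2 y).pow 2).div_const 32)).congr_deriv ?_
    rw [Real.cos_sq y]
    simp only [id]
    push_cast
    ring
  have hq : ∀ t, 0 ≤ t → α * (θ t / 2 - Real.sin (2 * θ t) / 4) ≤ q t := by
    intro t ht
    have := add_mul_le_of_le_deriv (u := fun t => q t - α * (θ t / 2 - Real.sin (2 * θ t) / 4))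
      (m := 0) ht (fun s hs => (H.hasDerivAt_q s hs.1).sub
        (((hp (θ s)).comp s (H.hasDerivAt_angle s hs.1)).const_mul α))
      (fun s _ => by
        have a1 : 0 ≤ α * (1 - Real.cos (2 * θ s)) :=
          mul_nonneg hα0 (by linarith [Real.cos_le_one (2 * θ s)])
        nlinarith [mul_nonneg a1 (sub_nonneg.2 (hspeed s))])
    simp only [H.q_zero, H.angle_zero] at this
    norm_num at this
    exact this
  have hmain := add_mul_le_of_le_deriv (m := 0) hT
    (u := fun t => turnTime h s₀ α (θ t) - t - c * s₀ ^ 2 / 4 * α *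
      (θ t ^ 2 / 8 + θ t * Real.sin (2 * θ t) / 8 + Real.cos (2 * θ t) / 8 +
        Real.cos (2 * θ t) ^ 2 / 32))
    (fun s hs => (((hasDerivAt_turnTime (s₀ := s₀) hc h0 hα (θ s)).comp s
      (H.hasDerivAt_angle s hs.1)).sub (hasDerivAt_id s)).sub
        (((hQ (θ s)).comp s (H.hasDerivAt_angle s hs.1)).const_mul (c * s₀ ^ 2 / 4 * α)))
    (fun s hs => by
      have a1 := speed_lower_bound (s₀ := s₀) h0 hα (θ s)
      have a2 : h (s₀ * Real.cos (θ s)) - α * Real.sin (2 * θ s) ≤ 2 := by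
        nlinarith [h1 (s₀ * Real.cos (θ s)), Real.neg_one_le_sin (2 * θ s)]
      have a3 := hspeed s
      have a4 := hp0 _ (hθ0 s hs.1)
      have a5 := hq s hs.1
      have a6 : α * (θ s / 2 - Real.sin (2 * θ s) / 4) ≤ 1 / 2 := by
        have : θ s / 2 - Real.sin (2 * θ s) / 4 ≤ 4 := by
          linarith [hθT s hs, Real.pi_lt_d2, Real.neg_one_le_sin (2 * θ s)]
        nlinarith
      have a7 := hgain (s₀ * Real.cos (θ s)) (Real.exp (-q s))
        (by rw [abs_mul, abs_of_nonneg hs₀]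
            exact mul_le_of_le_one_right hs₀ (Real.abs_cos_le_one _)) (Real.exp_pos _).le
        (by simpa using H.q_nonneg hα0 hs.1)
      rw [show Real.exp (-q s) * (s₀ * Real.cos (θ s)) = s₀ * Real.exp (-q s) * Real.cos (θ s) by
        ring] at a7
      generalize h (s₀ * Real.exp (-q s) * Real.cos (θ s)) = A at *
      generalize h (s₀ * Real.cos (θ s)) = B at *
      generalize θ s / 2 - Real.sin (2 * θ s) / 4 = p at *
      generalize α * Real.sin (2 * θ s) = z at *
      have a8 : α * p ≤ 1 - Real.exp (-q s) ^ 2 := by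
        have b1 : Real.exp (-q s) ^ 2 ≤ Real.exp (-(2 * (α * p))) := by
          rw [← Real.exp_nat_mul, Real.exp_le_exp]
          push_cast
          linarith
        have b2 : Real.exp (-(2 * (α * p))) ≤ 1 - α * p := by
          rw [Real.exp_neg]
          have b3 := Real.add_one_le_exp (2 * (α * p))
          have b4 : 0 ≤ α * p := by positivity
          refine inv_le_of_inv_le₀ (by linarith) (le_trans ?_ b3)
          rw [inv_le_iff_one_le_mul₀ (by linarith)]
          nlinarith
        linarith
      have a9 : c * s₀ ^ 2 * Real.cos (θ s) ^ 2 * (α * p) ≤ A - B := by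
        have := mul_le_mul_of_nonneg_left a8
          (show 0 ≤ c * s₀ ^ 2 * Real.cos (θ s) ^ 2 by positivity)
        nlinarith
      have hD : 0 < B - z := by linarith
      have hN : 0 ≤ c * s₀ ^ 2 * Real.cos (θ s) ^ 2 * (α * p) := by positivity
      have e1 : (B - z)⁻¹ * (A - z) - 1 = (A - B) / (B - z) := by
        field_simp
        ring
      have e2 : c * s₀ ^ 2 * Real.cos (θ s) ^ 2 * (α * p) / 2 ≤ (A - B) / (B - z) := by
        rw [div_le_div_iff₀ two_pos hD]
        nlinarith
      rw [e1]
      nlinarith [mul_le_mul_of_nonneg_left a3 hN])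
  simp only [H.angle_zero, hT2] at hmain
  have h3 : turnTime h s₀ α 0 = 0 := by simp [turnTime]
  have h4 : Real.sin (2 * (2 * Real.pi)) = 0 := by
    rw [Real.sin_two_mul, Real.sin_two_pi]; ring
  have h5 : Real.cos (2 * (2 * Real.pi)) = 1 := by
    rw [Real.cos_two_mul, Real.cos_two_pi]; ring
  rw [h3, h4, h5] at hmain
  simp only [mul_zero, Real.sin_zero, Real.cos_zero] at hmain
  linarith

end IsPhaseMotion

theorem eq_of_hasDerivWithinAt_of_locally_lipschitz {E : Type*} [NormedAddCommGroup E]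
    [NormedSpace ℝ E] {F : E → E} {u w : ℝ → E}
    (hF : ∀ t, 0 ≤ t → ∃ K, ∃ N ∈ 𝓝 (u t), LipschitzOnWith K F N)
    (hu : ∀ t, 0 ≤ t → HasDerivWithinAt u (F (u t)) (Ici 0) t)
    (hw : ∀ t, 0 ≤ t → HasDerivWithinAt w (F (w t)) (Ici 0) t) (h0 : u 0 = w 0) {T : ℝ}
    (hT : 0 ≤ T) : u T = w T := by
  have huc : ContinuousOn u (Icc 0 T) := fun t ht =>
    (hu t ht.1).continuousWithinAt.mono Icc_subset_Ici_self
  have hwc : ContinuousOn w (Icc 0 T) := fun t ht =>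
    (hw t ht.1).continuousWithinAt.mono Icc_subset_Ici_self
  have hclosed : IsClosed ({t | u t = w t} ∩ Icc 0 T) := by
    have := (huc.prodMk hwc).preimage_isClosed_of_isClosed isClosed_Icc isClosed_diagonal
    convert this using 1
    ext t
    simp [and_comm]
  refine hclosed.Icc_subset_of_forall_exists_gt h0 ?_ ⟨hT, le_rfl⟩
  rintro t ⟨htu, ht⟩ y hy
  have ht0 := ht.1
  have htu : u t = w t := htu
  have hy : t < y := hy
  obtain ⟨K, N, hN, hK⟩ := hF t ht0
  have hsub : Ici t ⊆ Ici (0 : ℝ) := Ici_subset_Ici.2 ht0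
  have hev : ∀ᶠ s in 𝓝[≥] t, u s ∈ N ∧ w s ∈ N :=
    (((hu t ht0).continuousWithinAt.mono hsub).tendsto.eventually hN).and
      (((hw t ht0).continuousWithinAt.mono hsub).tendsto.eventually (htu ▸ hN))
  obtain ⟨z, hz, hzN⟩ := (mem_nhdsGE_iff_exists_Icc_subset).1 hev
  have hz : t < z := hz
  have htb : t < min y z := lt_min hy hz
  refine ⟨min y z, ?_, htb, min_le_left _ _⟩
  refine ODE_solution_unique_of_mem_Icc_right (v := fun _ => F) (s := fun _ => N) (K := K)
    (a := t) (b := min y z) (fun _ _ => hK) ?_ ?_ ?_ ?_ ?_ ?_ htu ⟨htb.le, le_rfl⟩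
  · exact fun s hs => (hu s (ht0.trans hs.1)).continuousWithinAt.mono fun r hr => ht0.trans hr.1
  · exact fun s hs => (hu s (ht0.trans hs.1)).mono (Ici_subset_Ici.2 (ht0.trans hs.1))
  · exact fun s hs => (hzN ⟨hs.1, hs.2.le.trans (min_le_right _ _)⟩).1
  · exact fun s hs => (hw s (ht0.trans hs.1)).continuousWithinAt.mono fun r hr => ht0.trans hr.1
  · exact fun s hs => (hw s (ht0.trans hs.1)).mono (Ici_subset_Ici.2 (ht0.trans hs.1))
  · exact fun s hs => (hzN ⟨hs.1, hs.2.le.trans (min_le_right _ _)⟩).2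

theorem IsPendulumSolution.eq_of_contDiffAt {f : ℝ → ℝ} {x₀ α : ℝ} {x v y w : ℝ → ℝ}
    (h1 : IsPendulumSolution f x₀ α x v) (h2 : IsPendulumSolution f x₀ α y w)
    (hsm : ∀ t, 0 ≤ t → ContDiffAt ℝ 1 (fun x => x * (1 + f x)) (x t)) {t : ℝ} (ht : 0 ≤ t) :
    x t = y t := by
  have := eq_of_hasDerivWithinAt_of_locally_lipschitz
    (F := fun z : ℝ × ℝ => (z.2, -(2 * α * z.2) - z.1 * (1 + f z.1)))
    (u := fun t => (x t, v t)) (w := fun t => (y t, w t)) (fun s hs => ?_)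
    (fun s hs => (h1.deriv_pos s hs).prodMk (h1.deriv_vel s hs))
    (fun s hs => (h2.deriv_pos s hs).prodMk (h2.deriv_vel s hs))
    (by rw [h1.init_pos, h1.init_vel, h2.init_pos, h2.init_vel]) ht
  · exact (Prod.ext_iff.1 this).1
  · have hc : ContDiffAt ℝ 1 (fun z : ℝ × ℝ => (z.2, -(2 * α * z.2) - z.1 * (1 + f z.1)))
        (x s, v s) := by
      refine contDiffAt_snd.prodMk ((contDiffAt_const.mul contDiffAt_snd).neg.sub ?_)
      exact ContDiffAt.comp (x s, v s) (hsm s hs) contDiffAt_fst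
    exact hc.exists_lipschitzOnWith

namespace EnergyChart

variable {f X h : ℝ → ℝ} {R c s₀ α : ℝ} {q θ : ℝ → ℝ}

theorem isPendulumSolution (C : EnergyChart (fun x => x * (1 + f x)) R c X h) (hs : 0 < s₀)
    (hsR : s₀ ≤ R) (hα : 0 ≤ α) (H : IsPhaseMotion h s₀ α q θ) :
    IsPendulumSolution f (X s₀) α (fun t => X (s₀ * Real.exp (-q t) * Real.cos (θ t)))
      (fun t => -(s₀ * Real.exp (-q t) * Real.sin (θ t))) := by
  have hr : ∀ t, 0 ≤ t → HasDerivAt (fun t => s₀ * Real.exp (-q t))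
      (s₀ * (Real.exp (-q t) * -(α * (1 - Real.cos (2 * θ t))))) t := fun t ht =>
    ((H.hasDerivAt_q t ht).neg.exp).const_mul s₀
  refine ⟨by simp [H.q_zero, H.angle_zero], by simp [H.angle_zero], fun t ht => ?_, fun t ht => ?_⟩
  · have hb := (H.abs_amplitude_le hs.le hα ht).trans hsR
    have hpos := C.half_le (s₀ * Real.exp (-q t) * Real.cos (θ t))
    refine (((C.hasDerivAt _ hb).comp t ((hr t ht).mul (H.hasDerivAt_angle t ht).cos)).congr_deriv
      ?_).hasDerivWithinAt
    rw [inv_mul_eq_iff_eq_mul₀ (by linarith), Real.cos_two_mul, Real.sin_two_mul]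
    generalize h (s₀ * Real.exp (-q t) * Real.cos (θ t)) = A
    have e := Real.sin_sq_add_cos_sq (θ t)
    generalize Real.exp (-q t) = E
    linear_combination (-2 * s₀ * E * α * Real.cos (θ t)) * (-e)
  · have hb := (H.abs_amplitude_le hs.le hα ht).trans hsR
    have hforce := C.force _ hb
    refine ((((hr t ht).mul (H.hasDerivAt_angle t ht).sin).neg).congr_deriv ?_).hasDerivWithinAt
    rw [hforce, Real.cos_two_mul, Real.sin_two_mul]
    generalize h (s₀ * Real.exp (-q t) * Real.cos (θ t)) = A
    generalize Real.exp (-q t) = E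
    ring

theorem hasDerivAt_and_deriv_deriv (C : EnergyChart (fun x => x * (1 + f x)) R c X h)
    (hs : 0 < s₀) (hsR : s₀ ≤ R) (hα : 0 ≤ α) (H : IsPhaseMotion h s₀ α q θ) {t : ℝ} (ht : 0 < t) :
    HasDerivAt (fun t => X (s₀ * Real.exp (-q t) * Real.cos (θ t)))
        (-(s₀ * Real.exp (-q t) * Real.sin (θ t))) t ∧
      (Real.sin (θ t) = 0 → deriv (deriv fun t => X (s₀ * Real.exp (-q t) * Real.cos (θ t))) t =
        -(h (s₀ * Real.exp (-q t) * Real.cos (θ t)) * (s₀ * Real.exp (-q t) * Real.cos (θ t)))) := by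
  have S := C.isPendulumSolution hs hsR hα H
  have hx : ∀ r, 0 < r → HasDerivAt (fun t => X (s₀ * Real.exp (-q t) * Real.cos (θ t)))
        (-(s₀ * Real.exp (-q r) * Real.sin (θ r))) r := fun r hr =>
    (S.deriv_pos r hr.le).hasDerivAt (Ici_mem_nhds hr)
  refine ⟨hx t ht, fun hsin => ?_⟩
  have hv := (S.deriv_vel t ht.le).hasDerivAt (Ici_mem_nhds ht)
  have he : (deriv fun t => X (s₀ * Real.exp (-q t) * Real.cos (θ t))) =ᶠ[𝓝 t]
      fun t => -(s₀ * Real.exp (-q t) * Real.sin (θ t)) := by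
    filter_upwards [lt_mem_nhds ht] with r hr
    exact (hx r hr).deriv
  rw [he.deriv_eq, hv.deriv, hsin]
  have hforce := C.force _ ((H.abs_amplitude_le hs.le hα ht.le).trans hsR)
  rw [hforce]
  ring

theorem isLocalMax_of_full_turn (C : EnergyChart (fun x => x * (1 + f x)) R c X h)
    (hs : 0 < s₀) (hsR : s₀ ≤ R) (hα : 0 ≤ α) (H : IsPhaseMotion h s₀ α q θ) {t : ℝ} (ht : 0 < t)
    (hθ : θ t = 2 * Real.pi) :
    IsLocalMax (fun t => X (s₀ * Real.exp (-q t) * Real.cos (θ t))) t := by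
  obtain ⟨h1, h2⟩ := C.hasDerivAt_and_deriv_deriv hs hsR hα H ht
  have hsin : Real.sin (θ t) = 0 := by rw [hθ, Real.sin_two_pi]
  refine isLocalMax_of_deriv_deriv_neg ?_ ?_ h1.continuousAt
  · rw [h2 hsin, hθ, Real.cos_two_pi, mul_one, neg_lt_zero]
    have := C.half_le (s₀ * Real.exp (-q t))
    positivity
  · rw [h1.deriv, hsin]; simp

theorem two_pi_le_of_isLocalMax (C : EnergyChart (fun x => x * (1 + f x)) R c X h)
    (hs : 0 < s₀) (hsR : s₀ ≤ R) (hα : 0 ≤ α) (H : IsPhaseMotion h s₀ α q θ) {t : ℝ} (ht : 0 < t)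
    (hmax : IsLocalMax (fun t => X (s₀ * Real.exp (-q t) * Real.cos (θ t))) t) :
    2 * Real.pi ≤ θ t := by
  obtain ⟨h1, h2⟩ := C.hasDerivAt_and_deriv_deriv hs hsR hα H ht
  have hE : 0 < s₀ * Real.exp (-q t) := by positivity
  have hsin : Real.sin (θ t) = 0 := by
    have := hmax.hasDerivAt_eq_zero h1
    simpa [hE.ne', hs.ne'] using this
  obtain ⟨n, hn⟩ := Real.sin_eq_zero_iff.1 hsin
  have hpos := H.angle_pos C.half_le ht
  have hn0 : 0 < n := by
    rw [← hn] at hpos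
    exact_mod_cast pos_of_mul_pos_left hpos Real.pi_pos.le
  have hn1 : n ≠ 1 := by
    rintro rfl
    have hθ : θ t = Real.pi := by simpa using hn.symm
    have hdd := h2 hsin
    rw [hθ, Real.cos_pi] at hdd
    have hhalf := C.half_le (s₀ * Real.exp (-q t) * -1)
    have hddpos : 0 < deriv (deriv fun t => X (s₀ * Real.exp (-q t) * Real.cos (θ t))) t := by
      rw [hdd]
      nlinarith [mul_pos (show 0 < h (s₀ * Real.exp (-q t) * -1) by linarith) hE]
    have hmin := isLocalMin_of_deriv_deriv_pos hddpos (by rw [h1.deriv, hsin]; simp)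
      h1.continuousAt
    have hconst : (fun t => X (s₀ * Real.exp (-q t) * Real.cos (θ t))) =ᶠ[𝓝 t]
        fun _ => X (s₀ * Real.exp (-q t) * Real.cos (θ t)) := by
      filter_upwards [hmax, hmin] with r hr1 hr2
      exact le_antisymm hr1 hr2
    rw [hconst.deriv.deriv_eq] at hddpos
    simp at hddpos
  have hn2 : (2 : ℝ) ≤ n := by exact_mod_cast (show 2 ≤ n by omega)
  rw [← hn]
  exact mul_le_mul_of_nonneg_right hn2 Real.pi_pos.le

theorem isOscillationTime (C : EnergyChart (fun x => x * (1 + f x)) R c X h)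
    (hs : 0 < s₀) (hsR : s₀ ≤ R) (hα : 0 ≤ α) (H : IsPhaseMotion h s₀ α q θ) {T : ℝ} (hT : 0 ≤ T)
    (hθT : θ T = 2 * Real.pi) (hlt : ∀ t, 0 ≤ t → t < T → θ t < 2 * Real.pi) :
    IsOscillationTime f (X s₀) α T := by
  have S := C.isPendulumSolution hs hsR hα H
  have hT0 : 0 < T := by
    rcases hT.eq_or_lt with rfl | h
    · rw [H.angle_zero] at hθT
      linarith [Real.pi_pos]
    · exact h
  refine ⟨⟨_, _, S⟩, fun x v hxv => ?_⟩
  have heq : ∀ t, 0 ≤ t → X (s₀ * Real.exp (-q t) * Real.cos (θ t)) = x t := fun t ht =>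
    S.eq_of_contDiffAt hxv
      (fun r hr => C.smooth _ ((H.abs_amplitude_le hs.le hα hr).trans hsR)) ht
  have hloc : ∀ t, 0 < t → (fun t => X (s₀ * Real.exp (-q t) * Real.cos (θ t))) =ᶠ[𝓝 t] x :=
    fun t ht => by
      filter_upwards [lt_mem_nhds ht] with r hr
      exact heq r (le_of_lt hr)
  refine ⟨⟨hT0, ?_⟩, fun t ht => ?_⟩
  · exact (C.isLocalMax_of_full_turn hs hsR hα H hT0 hθT).congr (hloc T hT0)
  · have := C.two_pi_le_of_isLocalMax hs hsR hα H ht.1 (ht.2.congr (hloc t ht.1).symm)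
    by_contra! hcon
    linarith [hlt t ht.1.le hcon]

end EnergyChart

theorem IsOscillationTime.oscillationTime_eq {f : ℝ → ℝ} {x₀ α T : ℝ}
    (h : IsOscillationTime f x₀ α T) : oscillationTime f x₀ α = T := by
  obtain ⟨⟨x, v, hxv⟩, hT⟩ := h
  refine IsLeast.csInf_eq ⟨⟨(hT x v hxv).1.1, x, v, hxv, (hT x v hxv).1.2⟩, ?_⟩
  rintro t ⟨ht, y, w, hyw, hmax⟩
  exact (hT y w hyw).2 ⟨ht, hmax⟩

theorem IsPhaseMotion.exists_first_full_turn {h : ℝ → ℝ} {s₀ α : ℝ} {q θ : ℝ → ℝ}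
    (H : IsPhaseMotion h s₀ α q θ) (hex : ∃ t, 0 ≤ t ∧ θ t = 2 * Real.pi) :
    ∃ T, 0 ≤ T ∧ θ T = 2 * Real.pi ∧ ∀ t, 0 ≤ t → t < T → θ t < 2 * Real.pi := by
  obtain ⟨t₀, ht₀, hθ₀⟩ := hex
  have hcl : IsClosed (Icc 0 t₀ ∩ θ ⁻¹' {2 * Real.pi}) :=
    (H.continuousOn_angle t₀).preimage_isClosed_of_isClosed isClosed_Icc isClosed_singleton
  obtain ⟨T, ⟨hT, hθT⟩, hmin⟩ := (isCompact_Icc.of_isClosed_subset hcl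
    inter_subset_left).exists_isLeast ⟨t₀, ⟨ht₀, le_rfl⟩, hθ₀⟩
  refine ⟨T, hT.1, hθT, fun t ht htT => ?_⟩
  by_contra! hge
  obtain ⟨r, hr, hθr⟩ := H.exists_angle_eq ht (by positivity) hge
  have := hmin ⟨⟨hr.1, hr.2.trans (htT.le.trans hT.2)⟩, hθr⟩
  linarith [hr.2]

namespace EnergyChart

variable {f X h : ℝ → ℝ} {R c s₀ : ℝ}

theorem angle_le_of_critical_damping {q θ : ℝ → ℝ}
    (C : EnergyChart (fun x => x * (1 + f x)) R c X h) (hs : 0 < s₀)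
    (hsR : s₀ ≤ R) (H : IsPhaseMotion h s₀ 1 q θ) {t : ℝ} (ht : 0 ≤ t) :
    θ t ≤ Real.pi / 4 := by
  rcases ht.eq_or_lt with rfl | ht
  · rw [H.angle_zero]; positivity
  have := pos_of_deriv_pos_of_eq_zero (u := fun t => Real.pi / 4 - θ t) (a := 0)
    (fun t ht => (H.hasDerivAt_angle t ht).const_sub (Real.pi / 4))
    (by rw [H.angle_zero, sub_zero]; positivity) (fun r hr hz => ?_) ht
  · linarith
  · have hθ : θ r = Real.pi / 4 := by linarith
    have hgain := C.gain _ 0 ((H.abs_amplitude_le hs.le zero_le_one hr).trans hsR) le_rfl zero_le_one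
    rw [zero_mul, C.zero] at hgain
    rw [hθ] at hgain ⊢
    rw [show 2 * (Real.pi / 4) = Real.pi / 2 by ring, Real.sin_pi_div_two]
    have hne : 0 < s₀ * Real.exp (-q r) * Real.cos (Real.pi / 4) := by
      rw [Real.cos_pi_div_four]; positivity
    have hc := C.gain_pos
    have : 0 < c * ((s₀ * Real.exp (-q r) * Real.cos (Real.pi / 4)) ^ 2 * (1 - 0 ^ 2)) := by
      norm_num
      positivity
    linarith

theorem oscillationTime_properties (C : EnergyChart (fun x => x * (1 + f x)) R c X h)
    (hs : 0 < s₀) (hsR : s₀ ≤ R) :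
    (∀ α ∈ Ioo (0 : ℝ) 1, IsOscillationTime f (X s₀) α (oscillationTime f (X s₀) α)) ∧
      (∃ α₀ ∈ Ioo (0 : ℝ) 1, 0 < oscillationTime f (X s₀) α₀ ∧
        ∀ α ∈ Ioo (0 : ℝ) 1, oscillationTime f (X s₀) α₀ ≤ oscillationTime f (X s₀) α) ∧
      Tendsto (fun α : ℝ => oscillationTime f (X s₀) α) (𝓝[<] 1) atTop := by
  obtain ⟨K, hK⟩ := C.lipschitz
  have hmotion : ∀ α, ∃ q θ, α ∈ Icc (0 : ℝ) 1 → IsPhaseMotion h s₀ α q θ := by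
    intro α
    by_cases hα : α ∈ Icc (0 : ℝ) 1
    · obtain ⟨q, θ, H⟩ := IsPhaseMotion.exists_of_lipschitzWith hK C.half_le C.le_one hs hα
      exact ⟨q, θ, fun _ => H⟩
    · exact ⟨0, 0, fun h => absurd h hα⟩
  choose q θ H using hmotion
  have hturn : ∀ α, ∃ T, α ∈ Ioo (0 : ℝ) 1 →
      0 ≤ T ∧ θ α T = 2 * Real.pi ∧ ∀ t, 0 ≤ t → t < T → θ α t < 2 * Real.pi := by
    intro α
    by_cases hα : α ∈ Ioo (0 : ℝ) 1
    · have Hα := H α (Ioo_subset_Icc_self hα)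
      obtain ⟨T, hT⟩ := Hα.exists_first_full_turn
        (Hα.exists_full_turn hK C.half_le C.zero hα.1.le hα.2)
      exact ⟨T, fun _ => hT⟩
    · exact ⟨0, fun h => absurd h hα⟩
  choose τ hτ using hturn
  have hosc : ∀ α ∈ Ioo (0 : ℝ) 1, IsOscillationTime f (X s₀) α (τ α) := fun α hα =>
    C.isOscillationTime hs hsR hα.1.le (H α (Ioo_subset_Icc_self hα)) (hτ α hα).1 (hτ α hα).2.1
      (hτ α hα).2.2
  have hval : ∀ α ∈ Ioo (0 : ℝ) 1, oscillationTime f (X s₀) α = τ α := fun α hα =>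
    (hosc α hα).oscillationTime_eq
  have hpos : ∀ α ∈ Ioo (0 : ℝ) 1, 0 < τ α := fun α hα => by
    obtain ⟨⟨x, v, hxv⟩, hT⟩ := hosc α hα
    exact (hT x v hxv).1.1
  have hlsc : ∀ α ∈ Icc (0 : ℝ) 1, ∀ M, 0 ≤ M → (∀ t ∈ Icc 0 M, θ α t < 2 * Real.pi) →
      ∀ᶠ β in 𝓝 α, β ∈ Ioo (0 : ℝ) 1 → M < τ β := by
    intro α hα M hM hlt
    obtain ⟨t₁, ht₁, hmax⟩ := isCompact_Icc.exists_isMaxOn (nonempty_Icc.2 hM)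
      ((H α hα).continuousOn_angle M)
    filter_upwards [(H α hα).eventually_abs_sub_lt hK hs hα (T := M)
      (show 0 < 2 * Real.pi - θ α t₁ by linarith [hlt t₁ ht₁])] with β hβ hβI
    by_contra! hle
    have h1 := hβ (Ioo_subset_Icc_self hβI) _ _ (H β (Ioo_subset_Icc_self hβI)) (τ β)
      ⟨(hτ β hβI).1, hle⟩
    have h2 : θ α (τ β) ≤ θ α t₁ := hmax ⟨(hτ β hβI).1, hle⟩
    rw [(hτ β hβI).2.1] at h1
    linarith [le_abs_self (2 * Real.pi - θ α (τ β))]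
  have hone : ∀ M, 0 ≤ M → ∀ᶠ β in 𝓝 (1 : ℝ), β ∈ Ioo (0 : ℝ) 1 → M < τ β := fun M hM =>
    hlsc 1 ⟨zero_le_one, le_rfl⟩ M hM fun t ht =>
      (C.angle_le_of_critical_damping hs hsR (H 1 ⟨zero_le_one, le_rfl⟩) ht.1).trans_lt
        (by linarith [Real.pi_pos])
  refine ⟨fun α hα => (hval α hα).symm ▸ hosc α hα, ?_, ?_⟩
  · have hc := C.gain_pos
    have hκ : 0 < c * s₀ ^ 2 / 4 := by positivity
    set κ := c * s₀ ^ 2 / 4 with hκdef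
    obtain ⟨α₁, hα₁, hα₁8, hα₁κ⟩ : ∃ α₁ : ℝ, 0 < α₁ ∧ α₁ ≤ 1 / 8 ∧ α₁ ≤ κ * Real.pi / 128 :=
      ⟨min (1 / 8) (κ * Real.pi / 128), lt_min (by norm_num) (by positivity), min_le_left _ _,
        min_le_right _ _⟩
    have hα₁I : α₁ ∈ Ioo (0 : ℝ) 1 := ⟨hα₁, by linarith⟩
    have hfast : τ α₁ < turnTime h s₀ 0 (2 * Real.pi) := by
      have h1 := (H α₁ (Ioo_subset_Icc_self hα₁I)).add_le_turnTime hK.continuous C.half_le C.le_one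
        ⟨hα₁.le, hα₁8⟩ hs.le hc.le (fun s l hs' => C.gain s l (hs'.trans hsR)) (hτ α₁ hα₁I).1
        (fun t ht => by
          rcases ht.2.eq_or_lt with h | h
          · rw [h, (hτ α₁ hα₁I).2.1]
          · exact ((hτ α₁ hα₁I).2.2 t ht.1 h).le)
        (hτ α₁ hα₁I).2.1
      have h2 := turnTime_two_pi_le (s₀ := s₀) hK.continuous C.half_le
        (show α₁ ∈ Icc (0 : ℝ) (1 / 8) from ⟨hα₁.le, hα₁8⟩)
      rw [← hκdef] at h1
      have h3 : 32 * Real.pi * α₁ ^ 2 ≤ κ * α₁ * (Real.pi ^ 2 / 2) / 2 := by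
        have := mul_le_mul_of_nonneg_left hα₁κ (show 0 ≤ 32 * Real.pi * α₁ by positivity)
        linarith
      have h4 : 0 < κ * α₁ * (Real.pi ^ 2 / 2) := by positivity
      linarith
    have hzero : ∀ᶠ β in 𝓝 (0 : ℝ), β ∈ Ioo (0 : ℝ) 1 → τ α₁ < τ β := by
      have hI : (0 : ℝ) ∈ Icc (0 : ℝ) 1 := ⟨le_rfl, zero_le_one⟩
      refine hlsc 0 hI _ (hpos α₁ hα₁I).le fun t ht => ?_
      by_contra! hge
      obtain ⟨r, hr, hθr⟩ := (H 0 hI).exists_angle_eq ht.1 (by positivity) hge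
      have := (H 0 hI).turnTime_angle_of_undamped hK.continuous C.half_le hr.1
      rw [hθr] at this
      linarith [hr.2, ht.2]
    obtain ⟨ε, hε, hεlt⟩ := Metric.eventually_nhds_iff.1 hzero
    obtain ⟨η, hη, hηlt⟩ := Metric.eventually_nhds_iff.1 (hone _ (hpos α₁ hα₁I).le)
    have hout : ∀ β ∈ Ioo (0 : ℝ) 1, β ∉ Icc ε (1 - η) → τ α₁ < τ β := by
      intro β hβ hβI
      by_cases hβε : β < ε
      · exact hεlt (by rwa [Real.dist_eq, sub_zero, abs_of_pos hβ.1]) hβ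
      · have hβη : 1 - η < β := by
          by_contra! hle
          exact hβI ⟨not_lt.1 hβε, hle⟩
        exact hηlt (by rw [Real.dist_eq, abs_sub_comm, abs_of_pos (by linarith [hβ.2])]; linarith)
          hβ
    have hα₁K : α₁ ∈ Icc ε (1 - η) := by
      by_contra hcon
      exact lt_irrefl _ (hout α₁ hα₁I hcon)
    have hsub : Icc ε (1 - η) ⊆ Ioo 0 1 := fun β hβ => ⟨hε.trans_le hβ.1, by linarith [hβ.2]⟩
    have hL : LowerSemicontinuousOn τ (Icc ε (1 - η)) := by
      intro α hα y hy
      have hαI := hsub hα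
      have hev := hlsc α (Ioo_subset_Icc_self hαI) (max y 0) (le_max_right _ _) fun t ht =>
        (hτ α hαI).2.2 t ht.1 (ht.2.trans_lt (max_lt hy (hpos α hαI)))
      filter_upwards [hev.filter_mono nhdsWithin_le_nhds, self_mem_nhdsWithin] with β hβ hβK
      exact (le_max_left _ _).trans_lt (hβ (hsub hβK))
    obtain ⟨α₀, hα₀, hmin⟩ := hL.exists_isMinOn ⟨α₁, hα₁K⟩ isCompact_Icc
    refine ⟨α₀, hsub hα₀, by rw [hval _ (hsub hα₀)]; exact hpos _ (hsub hα₀), fun β hβ => ?_⟩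
    rw [hval _ (hsub hα₀), hval _ hβ]
    by_cases hβK : β ∈ Icc ε (1 - η)
    · exact hmin hβK
    · exact (hmin hα₁K : τ α₀ ≤ τ α₁).trans (hout β hβ hβK).le
  · refine tendsto_atTop.2 fun M => ?_
    filter_upwards [(hone (max M 0) (le_max_right _ _)).filter_mono nhdsWithin_le_nhds,
      Ioo_mem_nhdsLT (show (0 : ℝ) < 1 from zero_lt_one)] with β hβ hβI
    rw [hval β hβI]
    exact (le_max_left _ _).trans (hβ hβI).le

end EnergyChart

theorem theorem1 (f : ℝ → ℝ) (a : ℝ) (ha : 0 < a)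
    (hf_smooth : ContDiffAt ℝ 2 f 0)
    (hf_even : ∀ᶠ x in 𝓝 (0 : ℝ), f (-x) = f x)
    (hf_expansion : (fun x : ℝ => f x - (-a * x ^ 2)) =O[𝓝 0] (fun x : ℝ => |x| ^ 4)) :
    ∃ δ : ℝ, 0 < δ ∧ ∀ x₀ : ℝ, 0 < x₀ → x₀ < δ →
      (∀ α ∈ Ioo (0 : ℝ) 1, IsOscillationTime f x₀ α (oscillationTime f x₀ α)) ∧
      (∃ α₀ ∈ Ioo (0 : ℝ) 1, 0 < oscillationTime f x₀ α₀ ∧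
        ∀ α ∈ Ioo (0 : ℝ) 1, oscillationTime f x₀ α₀ ≤ oscillationTime f x₀ α) ∧
      Tendsto (fun α : ℝ => oscillationTime f x₀ α) (𝓝[<] 1) atTop := by
  obtain ⟨R, X, h, C, δ, hδ, hX⟩ := exists_energyChart ha hf_smooth hf_expansion
  refine ⟨δ, hδ, fun x₀ hx₀ hx₀δ => ?_⟩
  obtain ⟨s₀, hs₀, hs₀R, rfl⟩ := hX x₀ hx₀ hx₀δ
  exact C.oscillationTime_properties hs₀ hs₀R
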